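/- Let $n\ge 5$. Consider the network whose sources $S_1,\dots,S_n$ are the vertices and whose parties $A_{ij}$ ($1\le i<j\le n$) are the edges of the complete graph on $n$ vertices, $A_{ij}$ being connected exactly to $S_i$ and $S_j$. Each source distributes the state $\frac1{\sqrt n}\sum_{c=1}^n|c\rangle^{\otimes(n-1)}$ to the $n-1$ parties connected to it. Put $\mathcal S_{ij}=\{i+j,\,2(n+1)-(i+j)\}$ and let $R_{ij}$ be the number of pairs $(c_i,c_j)\in\{1,\dots,n\}^2$ with $c_i\ne c_j$ and $c_i+c_j\in\mathcal S_{ij}$. Party $A_{ij}$ measures in an orthonormal basis consisting of * $|c,c\rangle$, $1\le c\le n$ (output "color match $c$"), * $|c_i,c_j\rangle$ with $c_i\ne c_j$ and $c_i+c_j\notin\mathcal S_{ij}$, * the ambiguous outputs $|v_{ij,r}\rangle=\sum_{c_i\neq c_j,\ c_i+c_j\in\mathcal S_{ij}}\omega^{(c_i,c_j)}_{ij,r}|c_i,c_j\rangle$, $1\le r\le R_{ij}$, where the parameters $\omega$ are arbitrary complex numbers for which the $|v_{ij,r}\rangle$ are orthonormal. Let $P_\omega$ be the resulting joint distribution of the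 outputs. A classical strategy consists of independent random messages $s_i$ of the sources $S_i$ and, for each party $A_{ij}$, a random output whose law depends only on $(s_i,s_j)$; given all the messages, the outputs of the parties are independent. A distribution of outputs is nonlocal if no classical strategy produces it. A classical strategy is called Color-Matching (CM), with color functions $c_i=c_i(s_i)\in\{1,\dots,n\}$, if all the $c_i$ have a common law and, almost surely, for every $c$ the party $A_{ij}$ outputs color match $c$ if and only if $c_i=c_j=c$. 1. For every $\omega$: if colors $(c_1,\dots,c_n)\in\{1,\dots,n\}^n$ are such that for every $i<j$ some ambiguous vector $|v_{ij,r}\rangle$ has a nonzero coefficient at $|c_i,c_j\rangle$ (that is, with these source colors all the outputs can be ambiguous), then $(c_1,\dots,c_n)=(1,2,\dots,n)$ or $(c_1,\dots,c_n)=(n,n-1,\dots,1)$. 2. For every $\omega$, every classical strategy that produces $P_\omega$ is a CM strategy for some color functions that are uniformly distributed on $\{1,\dots,n\}$; and for any color functions for which it is a CM strategy, almost surely, if the outputs of all the parties are ambiguous, then the list of colors $(c_1,\dots,c_n)$ of the sources is $(1,2,\dots,n)$ or $(n,n-1,\dots,1)$. 3. For some choice of the parameters $\omega$, the distribution $P_\omega$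 is nonlocal. -/

import Mathlib

open MeasureTheory

universe u

namespace NetworkNonlocality

/-- A network without inputs: a bipartite graph between a set `I` of sources and a set `J` of
parties, given by the set of sources connected to each party. -/
structure Network (I J : Type) where
  sources : J → Finset I

/-! ### Classical strategies -/

/-- A classical strategy in the network `N` with output alphabets `O j`.  Independently of the other
sources, source `i` sends a random message of law `law i` to all the parties connected to it; a
party `j` that receives the messages `s` outputs `a` with probability `resp j s a`. -/
structure ClassicalStrategy {I J : Type} (N : Network I J) (O : J → Type)
    [∀ j, Fintype (O j)] where
  Msg : I → Type u
  [measurableSpace : ∀ i, MeasurableSpace (Msg i)]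
  law : ∀ i, Measure (Msg i)
  [isProbability : ∀ i, IsProbabilityMeasure (law i)]
  resp : ∀ j, (∀ i : N.sources j, Msg i) → O j → ℝ
  measurable_resp : ∀ j a, Measurable fun s => resp j s a
  resp_nonneg : ∀ j s a, 0 ≤ resp j s a
  sum_resp : ∀ j s, ∑ a, resp j s a = 1

attribute [instance] ClassicalStrategy.measurableSpace ClassicalStrategy.isProbability

namespace ClassicalStrategy

variable {I J : Type} [Fintype I] {N : Network I J} {O : J → Type} [∀ j, Fintype (O j)]

/-- The joint law of all the (independent) messages of the sources. -/
noncomputable def messageLaw (S : ClassicalStrategy.{u} N O) : Measure (∀ i, S.Msg i) :=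
  Measure.pi S.law

/-- The probability that party `j` outputs `a` when the messages of the sources are `s`. -/
def response (S : ClassicalStrategy.{u} N O) (s : ∀ i, S.Msg i) (j : J) (a : O j) : ℝ :=
  S.resp j ((N.sources j).restrict s) a

/-- The joint distribution of the outputs. -/
noncomputable def dist [Fintype J] (S : ClassicalStrategy.{u} N O) (a : ∀ j, O j) : ℝ :=
  ∫ s, ∏ j, S.response s j (a j) ∂S.messageLaw

/-- The classical strategy `S` is Color-Matching with `C` colors, color distribution `p`,
color `col i s` attached to the message `s` of source `i`, and output `matchOut j c` of
party `j` standing for "color match `c`": each source takes color `c` with probability `p c`, and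
a party outputs color match `c` if and only if all the sources connected to it take color `c`
(almost surely). -/
structure IsColorMatching (S : ClassicalStrategy.{u} N O) {C : ℕ} (matchOut : ∀ j, Fin C → O j)
    (p : Fin C → ℝ) (col : ∀ i, S.Msg i → Fin C) : Prop where
  measurable_col : ∀ i, Measurable (col i)
  color_law : ∀ i c, (S.law i).real {m | col i m = c} = p c
  color_match : ∀ j, ∀ᵐ s ∂S.messageLaw, ∀ c,
    S.response s j (matchOut j c) = if ∀ i ∈ N.sources j, col i (s i) = c then 1 else 0

end ClassicalStrategy

/-- `P` can be produced by some classical strategy in the network `N`. -/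
def IsLocal {I J : Type} [Fintype I] [Fintype J] (N : Network I J) {O : J → Type}
    [∀ j, Fintype (O j)] (P : (∀ j, O j) → ℝ) : Prop :=
  ∃ S : ClassicalStrategy.{u} N O, ∀ a, S.dist a = P a

/-! ### Quantum strategies -/

/-- A quantum strategy: to each arrow from a source `i` to a party `j` is attached the Hilbert space
`ℂ ^ dim i j`; source `i` distributes the pure state `state i` of the tensor product over the
parties connected to it (written in the product basis), and party `j` performs the projective
measurement `proj j` on the tensor product over the sources connected to it. -/
structure QuantumStrategy {I J : Type} [DecidableEq I] [Fintype J] [DecidableEq J]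
    (N : Network I J) (O : J → Type) [∀ j, Fintype (O j)] where
  dim : I → J → ℕ
  state : ∀ i, (∀ j : {j // i ∈ N.sources j}, Fin (dim i j)) → ℂ
  proj : ∀ j, O j →
    Matrix (∀ i : N.sources j, Fin (dim i j)) (∀ i : N.sources j, Fin (dim i j)) ℂ
  norm_state : ∀ i, ∑ x, ‖state i x‖ ^ 2 = 1
  isHermitian_proj : ∀ j a, (proj j a).IsHermitian
  proj_mul_self : ∀ j a, proj j a * proj j a = proj j a
  sum_proj : ∀ j, ∑ a, proj j a = 1

namespace QuantumStrategy

variable {I J : Type} [Fintype I] [DecidableEq I] [Fintype J] [DecidableEq J] {N : Network I J}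
  {O : J → Type} [∀ j, Fintype (O j)]

/-- Labels of the product basis of the tensor product of the Hilbert spaces of all arrows. -/
abbrev Index (Q : QuantumStrategy N O) : Type :=
  ∀ e : (Σ j, N.sources j), Fin (Q.dim e.2 e.1)

/-- The tensor product of the states of all sources. -/
noncomputable def globalState (Q : QuantumStrategy N O) (x : Q.Index) : ℂ :=
  ∏ i, Q.state i fun j => x ⟨j.1, ⟨i, j.2⟩⟩

/-- The tensor product of the projections of all parties for the outputs `a`. -/
noncomputable def globalProj (Q : QuantumStrategy N O) (a : ∀ j, O j) :
    Matrix Q.Index Q.Index ℂ :=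
  Matrix.of fun x y => ∏ j, Q.proj j (a j) (fun i => x ⟨j, i⟩) (fun i => y ⟨j, i⟩)

/-- The joint distribution of the outputs, `Tr (|Ψ⟩⟨Ψ| ⬝ ⨂ⱼ Πⱼ)`. -/
noncomputable def dist (Q : QuantumStrategy N O) (a : ∀ j, O j) : ℝ :=
  (Matrix.trace
    (Matrix.vecMulVec Q.globalState (star Q.globalState) * Q.globalProj a)).re

end QuantumStrategy

/-! ### The graph-coloring network

Sources and colors are labelled by `Fin n`; the element `k : Fin n` stands for the number
`k + 1` of `{1, …, n}`. -/

/-- The parties: the edges `i < j` of the complete graph on `n` vertices. -/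
abbrev Edge (n : ℕ) : Type := {e : Fin n × Fin n // e.1 < e.2}

/-- The network whose sources are the vertices and whose parties are the edges of the complete graph
on `n` vertices; a party is connected to the two ends of its edge. -/
def completeNetwork (n : ℕ) : Network (Fin n) (Edge n) where
  sources e := {e.1.1, e.1.2}

/-- For `e = (i, j)` and `p = (cᵢ, cⱼ)` in numbers from `1` to `n`:
`cᵢ + cⱼ ∈ {i + j, 2 (n + 1) - (i + j)}`. -/
def SumCondition (n : ℕ) (e : Edge n) (p : Fin n × Fin n) : Prop :=
  ((p.1 : ℕ) + 1) + ((p.2 : ℕ) + 1) = ((e.1.1 : ℕ) + 1) + ((e.1.2 : ℕ) + 1) ∨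
  (((p.1 : ℕ) + 1) + ((p.2 : ℕ) + 1)) + (((e.1.1 : ℕ) + 1) + ((e.1.2 : ℕ) + 1)) = 2 * (n + 1)

instance (n : ℕ) (e : Edge n) (p : Fin n × Fin n) : Decidable (SumCondition n e p) := by
  unfold SumCondition; infer_instance

/-- The pairs of distinct colors measured in superposition by the party `e`. -/
abbrev AmbiguousPair (n : ℕ) (e : Edge n) : Type :=
  {p : Fin n × Fin n // p.1 ≠ p.2 ∧ SumCondition n e p}

/-- The pairs of distinct colors measured in the computational basis by the party `e`. -/
abbrev RefinedPair (n : ℕ) (e : Edge n) : Type :=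
  {p : Fin n × Fin n // p.1 ≠ p.2 ∧ ¬ SumCondition n e p}

/-- The number `R` of ambiguous outputs of the party `e`. -/
abbrev numAmbiguous (n : ℕ) (e : Edge n) : ℕ := Fintype.card (AmbiguousPair n e)

/-- The outputs of the party `e`: color matches, refined outputs `|cᵢ, cⱼ⟩`, and ambiguous outputs
`|v_r⟩`. -/
abbrev Outcome (n : ℕ) (e : Edge n) : Type :=
  Fin n ⊕ RefinedPair n e ⊕ Fin (numAmbiguous n e)

/-- The output "color match `c`". -/
abbrev matchOutcome (n : ℕ) (e : Edge n) (c : Fin n) : Outcome n e := Sum.inl c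

/-- The ambiguous output `|v_r⟩`. -/
abbrev ambiguousOutcome (n : ℕ) (e : Edge n) (r : Fin (numAmbiguous n e)) : Outcome n e :=
  Sum.inr (Sum.inr r)

/-- The parameters of the measurement bases: the coefficients
`ω e r (cᵢ, cⱼ)` of the vectors `|v_r⟩`, which have to be orthonormal. -/
structure MeasurementParams (n : ℕ) where
  ω : ∀ e : Edge n, Matrix (Fin (numAmbiguous n e)) (AmbiguousPair n e) ℂ
  orthonormal : ∀ e, ω e * (ω e).conjTranspose = 1

/-- The measurement basis of the party `e`, as vectors of `ℂⁿ ⊗ ℂⁿ`. -/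
def MeasurementParams.basisVector {n : ℕ} (W : MeasurementParams n) (e : Edge n) :
    Outcome n e → Fin n × Fin n → ℂ
  | Sum.inl c => Pi.single (c, c) 1
  | Sum.inr (Sum.inl p) => Pi.single p.1 1
  | Sum.inr (Sum.inr r) => fun p =>
      if h : p.1 ≠ p.2 ∧ SumCondition n e p then W.ω e r ⟨p, h⟩ else 0

/-- The labels received by the party `e = (i, j)` from its sources, as a pair, the one from
source `i` first. -/
def receivedPair {n : ℕ} (e : Edge n) (x : ∀ _ : (completeNetwork n).sources e, Fin n) :
    Fin n × Fin n :=
  (x ⟨e.1.1, by simp [completeNetwork]⟩, x ⟨e.1.2, by simp [completeNetwork]⟩)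

/-- The projection onto the basis vector labelled by the output `a`. -/
def MeasurementParams.projection {n : ℕ} (W : MeasurementParams n) (e : Edge n)
    (a : Outcome n e) :
    Matrix (∀ _ : (completeNetwork n).sources e, Fin n)
      (∀ _ : (completeNetwork n).sources e, Fin n) ℂ :=
  (Matrix.vecMulVec (W.basisVector e a) (star (W.basisVector e a))).submatrix
    (receivedPair e) (receivedPair e)

/-- The coherent uniform superposition `n^(-1/2) ∑_c |c, …, c⟩` of the colors, sent by source `i`. -/
noncomputable def colorState (n : ℕ) (i : Fin n)
    (x : ∀ _ : {e // i ∈ (completeNetwork n).sources e}, Fin n) : ℂ :=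
  (1 / (Real.sqrt n : ℂ)) * ∑ c : Fin n, if ∀ e, x e = c then 1 else 0

theorem receivedPair_injective {n : ℕ} (e : Edge n) :
    Function.Injective (receivedPair (n := n) e) := by
  intro x y h
  funext ⟨i, hi⟩
  have hi' : i = e.1.1 ∨ i = e.1.2 := by simpa [completeNetwork] using hi
  simp only [receivedPair, Prod.mk.injEq] at h
  rcases hi' with rfl | rfl
  · exact h.1
  · exact h.2

theorem receivedPair_surjective {n : ℕ} (e : Edge n) :
    Function.Surjective (receivedPair (n := n) e) := by
  rintro ⟨a, b⟩
  refine ⟨fun i => if i.1 = e.1.1 then a else b, ?_⟩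
  have h : e.1.2 ≠ e.1.1 := ne_of_gt e.2
  simp [receivedPair, h]

theorem sum_subtype_eq_sum_dite {α : Type} [Fintype α] (P : α → Prop) [DecidablePred P]
    (f : {p // P p} → ℂ) : ∑ j, f j = ∑ p, if h : P p then f ⟨p, h⟩ else 0 := by
  rw [← Fintype.sum_subtype_add_sum_subtype P (fun p => if h : P p then f ⟨p, h⟩ else 0)]
  have h2 : ∑ i : {x // ¬ P x}, (if h : P i.1 then f ⟨i.1, h⟩ else 0) = 0 :=
    Finset.sum_eq_zero fun i _ => dif_neg i.2
  rw [h2, add_zero]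
  refine Finset.sum_congr rfl fun i _ => ?_
  rw [dif_pos i.2]

theorem MeasurementParams.sum_basisVector_sq {n : ℕ} (W : MeasurementParams n) (e : Edge n)
    (a : Outcome n e) : ∑ p, star (W.basisVector e a p) * W.basisVector e a p = 1 := by
  rcases a with c | q | r
  · simp [basisVector, Pi.single_apply]
  · simp [basisVector, Pi.single_apply]
  · have h := congrFun (congrFun (W.orthonormal e) r) r
    rw [Matrix.mul_apply, Matrix.one_apply_eq, sum_subtype_eq_sum_dite] at h
    rw [← h]
    refine Finset.sum_congr rfl fun p _ => ?_
    by_cases hp : p.1 ≠ p.2 ∧ SumCondition n e p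
    · simp only [basisVector, dif_pos hp, Matrix.conjTranspose_apply]
      ring
    · simp only [basisVector, dif_neg hp]
      simp

theorem MeasurementParams.sum_basisVector_mul {n : ℕ} (W : MeasurementParams n) (e : Edge n)
    (p q : Fin n × Fin n) :
    ∑ a, W.basisVector e a p * star (W.basisVector e a q) = if p = q then 1 else 0 := by
  have hW : (W.ω e).conjTranspose * W.ω e = 1 :=
    (Matrix.mul_eq_one_comm_of_card_eq _ _ _ (Fintype.card_fin _)).mp (W.orthonormal e)
  have h1 : ∑ c : Fin n, W.basisVector e (Sum.inl c) p * star (W.basisVector e (Sum.inl c) q)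
      = if p = q ∧ p.1 = p.2 then 1 else 0 := by
    obtain ⟨p1, p2⟩ := p
    obtain ⟨q1, q2⟩ := q
    by_cases h : p1 = p2
    · subst h
      rw [Finset.sum_eq_single p1]
      · by_cases h' : q1 = p1 <;> by_cases h'' : q2 = p1 <;>
          simp [basisVector, Pi.single_apply, h', h'', eq_comm]
      · intro c _ hc
        simp [basisVector, Pi.single_apply, Ne.symm hc]
      · simp
    · simp only [h, and_false, if_false]
      refine Finset.sum_eq_zero fun c _ => ?_
      have : ¬ (p1 = c ∧ p2 = c) := fun hh => h (hh.1.trans hh.2.symm)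
      simp [basisVector, Pi.single_apply, this]
  have h2 : ∑ u : RefinedPair n e, W.basisVector e (Sum.inr (Sum.inl u)) p *
      star (W.basisVector e (Sum.inr (Sum.inl u)) q)
      = if p = q ∧ (p.1 ≠ p.2 ∧ ¬ SumCondition n e p) then 1 else 0 := by
    rw [sum_subtype_eq_sum_dite (fun p : Fin n × Fin n => p.1 ≠ p.2 ∧ ¬ SumCondition n e p)]
    rw [Finset.sum_eq_single p]
    · by_cases hp : p.1 ≠ p.2 ∧ ¬ SumCondition n e p
      · rw [dif_pos hp]
        by_cases hpq : p = q
        · subst hpq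
          simp [basisVector, hp]
        · have hqp : q ≠ p := Ne.symm hpq
          simp [basisVector, hpq, hqp]
      · rw [dif_neg hp, if_neg fun h => hp h.2]
    · intro c _ hc
      split_ifs with h
      · simp [basisVector, Pi.single_apply, Ne.symm hc]
      · rfl
    · simp
  have h3 : ∑ r, W.basisVector e (Sum.inr (Sum.inr r)) p *
      star (W.basisVector e (Sum.inr (Sum.inr r)) q)
      = if p = q ∧ (p.1 ≠ p.2 ∧ SumCondition n e p) then 1 else 0 := by
    by_cases hp : p.1 ≠ p.2 ∧ SumCondition n e p
    · by_cases hq : q.1 ≠ q.2 ∧ SumCondition n e q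
      · have h := congrFun (congrFun hW ⟨q, hq⟩) ⟨p, hp⟩
        rw [Matrix.mul_apply, Matrix.one_apply] at h
        simp only [basisVector, dif_pos hp, dif_pos hq]
        have e1 : (if p = q ∧ (p.1 ≠ p.2 ∧ SumCondition n e p) then (1 : ℂ) else 0)
            = if (⟨q, hq⟩ : AmbiguousPair n e) = ⟨p, hp⟩ then 1 else 0 := by
          simp only [Subtype.mk.injEq, hp, and_true, ne_eq, not_false_eq_true, eq_comm (a := p)]
        rw [e1, ← h]
        refine Finset.sum_congr rfl fun r _ => ?_
        rw [Matrix.conjTranspose_apply, mul_comm]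
      · have hpq : ¬ (p = q ∧ (p.1 ≠ p.2 ∧ SumCondition n e p)) := by
          rintro ⟨rfl, h⟩
          exact hq h
        simp only [basisVector, dif_neg hq, if_neg hpq]
        simp
    · rw [if_neg fun h => hp h.2]
      simp only [basisVector, dif_neg hp]
      simp
  rw [Fintype.sum_sum_type, Fintype.sum_sum_type, h1, h2, h3]
  by_cases hpq : p = q
  · by_cases hp : p.1 = p.2
    · simp [hpq, hpq ▸ hp]
    · by_cases hs : SumCondition n e p
      · simp [hpq, hpq ▸ hp, hpq ▸ hs]
      · simp [hpq, hpq ▸ hp, hpq ▸ hs]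
  · simp [hpq]

theorem norm_colorState {n : ℕ} (hn : 2 ≤ n) (i : Fin n) : ∑ x, ‖colorState n i x‖ ^ 2 = 1 := by
  obtain ⟨k, hk⟩ : ∃ k : Fin n, k ≠ i :=
    Fintype.exists_ne_of_one_lt_card (by rw [Fintype.card_fin]; omega) i
  obtain ⟨e0⟩ : Nonempty {e // i ∈ (completeNetwork n).sources e} := by
    rcases lt_or_gt_of_ne hk with h | h
    · exact ⟨⟨⟨(k, i), h⟩, by simp [completeNetwork]⟩⟩
    · exact ⟨⟨⟨(i, k), h⟩, by simp [completeNetwork]⟩⟩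
  have key : ∀ x : (∀ _ : {e // i ∈ (completeNetwork n).sources e}, Fin n),
      ‖colorState n i x‖ ^ 2 = (1 / n : ℝ) * ∑ c : Fin n, if x = fun _ => c then 1 else 0 := by
    intro x
    have hc : ∀ c, (∀ e, x e = c) ↔ x = fun _ => c := fun c => funext_iff.symm
    simp only [colorState, hc]
    by_cases h : ∃ c, x = fun _ => c
    · obtain ⟨c, rfl⟩ := h
      have : ∀ d : Fin n, ((fun _ : {e // i ∈ (completeNetwork n).sources e} => c) = fun _ => d) ↔
          c = d := fun d => ⟨fun h => congrFun h e0, fun h => by rw [h]⟩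
      simp [this]
    · have : ∀ d : Fin n, ¬ (x = fun _ => d) := fun d hd => h ⟨d, hd⟩
      simp [this]
  simp only [key]
  rw [← Finset.mul_sum, Finset.sum_comm]
  have : (n : ℝ) ≠ 0 := by positivity
  simp [this]

theorem MeasurementParams.isHermitian_projection {n : ℕ} (W : MeasurementParams n) (e : Edge n)
    (a : Outcome n e) : (W.projection e a).IsHermitian := by
  ext x y
  simp [projection, Matrix.vecMulVec_apply, mul_comm]

theorem MeasurementParams.projection_mul_self {n : ℕ} (W : MeasurementParams n) (e : Edge n)
    (a : Outcome n e) : W.projection e a * W.projection e a = W.projection e a := by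
  have hb : Function.Bijective (receivedPair (n := n) e) :=
    ⟨receivedPair_injective e, receivedPair_surjective e⟩
  have h : star (W.basisVector e a) ⬝ᵥ W.basisVector e a = 1 := W.sum_basisVector_sq e a
  simp only [projection]
  rw [Matrix.submatrix_mul _ _ _ _ _ hb |>.symm, Matrix.vecMulVec_mul_vecMulVec, h, one_smul]

theorem MeasurementParams.sum_projection {n : ℕ} (W : MeasurementParams n) (e : Edge n) :
    ∑ a, W.projection e a = 1 := by
  ext x y
  rw [Matrix.sum_apply]
  simp only [projection, Matrix.submatrix_apply, Matrix.vecMulVec_apply, Pi.star_apply]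
  rw [W.sum_basisVector_mul, Matrix.one_apply]
  simp only [(receivedPair_injective e).eq_iff]

/-- The quantum Color-Matching strategy with `n` colors: every source distributes the coherent
uniform superposition of the `n` colors, and every party measures in the basis with parameters
`W`. -/
noncomputable def colorStrategy {n : ℕ} (hn : 2 ≤ n) (W : MeasurementParams n) :
    QuantumStrategy (completeNetwork n) (Outcome n) where
  dim _ _ := n
  state := colorState n
  proj := W.projection
  norm_state := norm_colorState hn
  isHermitian_proj := W.isHermitian_projection
  proj_mul_self := W.projection_mul_self
  sum_proj := W.sum_projection

end NetworkNonlocality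

open NetworkNonlocality

namespace NetworkNonlocality

set_option linter.unusedSectionVars false

/-! ### Colorings for which all outputs can be ambiguous -/

/-! Part 1 is a count. Center the labels: X_k = 2k - (n - 1), so that ∑ X = 0 and the sum condition
at an edge reads (X_{c_i} + X_{c_j})² = (X_i + X_j)². As adjacent vertices get distinct colors, c is
a permutation. Fix i and sum the difference of the two sides over all j: only j = i contributes,
giving 4(X_{c_i}² - X_i²), while expanding gives n(X_{c_i}² - X_i²). Since n > 4, X_{c_i} = ±X_i,
and the pair conditions make the sign global.

Part 2 is rigidity of Finner's inequality. Color matches have the same joint law as for independent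
uniform colors, because summing over the free outputs kills interference as long as at most one
party is left with a superposition (`colorStrategy_sum_dist`). Hence each triangle saturates
Finner's inequality; the equality case (`triangle_finner_equality`) makes the match responses
products of one-source functions, and the probabilities of two matches sharing a source force these
to be indicators (`exists_color_sets`). The resulting sets for the n colors partition the messages
of a source (`exists_isColorMatching`). For any such color functions, an output given the two colors
has its quantum law (`integral_response_mul_colorIndicator`), so all-ambiguous outputs force colors
as in part 1.

For part 3 each party rotates the pairs of the identity and of the reversed coloring into each other
by a small angle. An output string is then a set t of edges, with probability n^(-n)(A_t + B_t)²,
where A and B are the amplitudes of the two colorings. Classically, on the event of the identity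
coloring, the expectation of L - |t| depends only on one-edge marginals, so the mean of (L - |t|)₊
over all strings is at least n^(-n)(L - ∑ σ_e²). In the quantum law this mean also contains the
interference ∑ (L - |t|)₊ 2 A_t B_t, a nonzero multiple of ∏ σ_e whose sign can be made negative;
for small angles it dominates all other corrections (`exists_angles`) and breaks the bound
(`not_simulates_of_angles`). -/

/-- Twice the signed distance of `k` from the center of `Fin n`. -/
def centered (n : ℕ) (k : Fin n) : ℤ := 2 * (k : ℤ) - (n - 1)

theorem centered_injective (n : ℕ) : Function.Injective (centered n) := by
  intro a b h
  simp only [centered] at h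
  exact Fin.ext (by omega)

theorem centered_rev {n : ℕ} (k : Fin n) : centered n k.rev = -centered n k := by
  simp only [centered, Fin.val_rev]
  have := k.2
  omega

theorem sum_centered (n : ℕ) : ∑ k, centered n k = 0 := by
  have h := Equiv.sum_comp Fin.revPerm (centered n)
  simp only [Fin.revPerm_apply, centered_rev, Finset.sum_neg_distrib] at h
  linarith

/-- The two admissible sums are symmetric about n + 1, so after centering they differ by a sign and
a square absorbs the alternative. -/
theorem SumCondition.sq_centered_add {n : ℕ} {e : Edge n} {p : Fin n × Fin n}
    (h : SumCondition n e p) :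
    (centered n p.1 + centered n p.2) ^ 2 = (centered n e.1.1 + centered n e.1.2) ^ 2 := by
  simp only [sq_eq_sq_iff_eq_or_eq_neg, centered]
  rcases h with h | h
  · left; omega
  · right; omega

theorem eq_id_or_eq_rev_of_sumCondition {n : ℕ} (hn : 5 ≤ n) (c : Fin n → Fin n)
    (hc : ∀ e : Edge n, c e.1.1 ≠ c e.1.2 ∧ SumCondition n e (c e.1.1, c e.1.2)) :
    (∀ i, c i = i) ∨ (∀ i, c i = i.rev) := by
  have hinj : Function.Injective c := by
    intro i j hij
    by_contra hne
    rcases lt_or_gt_of_ne hne with h | h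
    · exact (hc ⟨(i, j), h⟩).1 hij
    · exact (hc ⟨(j, i), h⟩).1 hij.symm
  have hbij : Function.Bijective c := Finite.injective_iff_bijective.mp hinj
  set X := centered n
  have hpair : ∀ i j, i ≠ j → (X (c i) + X (c j)) ^ 2 = (X i + X j) ^ 2 := by
    intro i j hij
    rcases lt_or_gt_of_ne hij with h | h
    · exact (hc ⟨(i, j), h⟩).2.sq_centered_add
    · have := (hc ⟨(j, i), h⟩).2.sq_centered_add
      simp only at this
      rw [add_comm, this, add_comm]
  have hsum (f : Fin n → ℤ) : ∑ i, f (c i) = ∑ i, f i :=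
    Equiv.sum_comp (Equiv.ofBijective c hbij) f
  have hexp (x : ℤ) : ∑ j, (x + X j) ^ 2 = n * x ^ 2 + ∑ j, X j ^ 2 := by
    simp only [add_sq, Finset.sum_add_distrib, ← Finset.mul_sum]
    rw [show ∑ j, X j = 0 from sum_centered n]
    simp
  have hsq : ∀ i, X (c i) ^ 2 = X i ^ 2 := by
    intro i
    -- Off j = i the terms cancel. Below, the same sum is evaluated through bijectivity of `c` and ∑
    -- X = 0, giving n times the difference of squares.
    have h1 : ∑ j, ((X (c i) + X (c j)) ^ 2 - (X i + X j) ^ 2) = 4 * X (c i) ^ 2 - 4 * X i ^ 2 := by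
      rw [Finset.sum_eq_single i]
      · ring
      · intro j _ hj
        rw [hpair i j hj.symm, sub_self]
      · simp
    rw [Finset.sum_sub_distrib, hsum fun k => (X (c i) + X k) ^ 2, hexp, hexp] at h1
    have h2 : ((n : ℤ) - 4) * (X (c i) ^ 2 - X i ^ 2) = 0 := by linarith
    rcases mul_eq_zero.mp h2 with h | h
    · omega
    · linarith
  have hsign : ∀ i, X (c i) = X i ∨ X (c i) = -X i := fun i => sq_eq_sq_iff_eq_or_eq_neg.mp (hsq i)
  -- Vertex 0 is off center, so it fixes the sign. A vertex j of the opposite sign would satisfy (X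
  -- z - X j)² = (X z + X j)², hence X j = 0, where both signs agree.
  let z : Fin n := ⟨0, by omega⟩
  have hz : X z ≠ 0 := by
    simp only [X, z, centered]
    push_cast
    omega
  rcases hsign z with h0 | h0
  · left
    intro j
    apply centered_injective n
    rcases hsign j with h | h
    · exact h
    · by_cases hj : z = j
      · rw [← hj]; exact h0
      have := hpair z j hj
      rw [h0, h] at this
      have h3 : X z * X j = 0 := by linarith
      have h4 : X j = 0 := (mul_eq_zero.mp h3).resolve_left hz
      change X (c j) = X j
      rw [h, h4, neg_zero]
  · right
    intro j
    apply centered_injective n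
    rw [centered_rev]
    rcases hsign j with h | h
    · by_cases hj : z = j
      · rw [← hj]; exact h0
      have := hpair z j hj
      rw [h0, h] at this
      have h3 : X z * X j = 0 := by linarith
      have h4 : X j = 0 := (mul_eq_zero.mp h3).resolve_left hz
      change X (c j) = -X j
      rw [h, h4, neg_zero]
    · exact h

theorem MeasurementParams.eq_id_or_eq_rev {n : ℕ} (hn : 5 ≤ n) (W : MeasurementParams n)
    (c : Fin n → Fin n)
    (hc : ∀ e : Edge n, ∃ r, W.basisVector e (ambiguousOutcome n e r) (c e.1.1, c e.1.2) ≠ 0) :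
    (∀ i, c i = i) ∨ (∀ i, c i = i.rev) := by
  refine eq_id_or_eq_rev_of_sumCondition hn c fun e => ?_
  obtain ⟨r, hr⟩ := hc e
  by_contra h
  exact hr (dif_neg h)

/-! ### The quantum distribution -/

/-- The pair of colors of the ends of an edge. -/
abbrev Edge.colors {n : ℕ} (e : Edge n) (c : Fin n → Fin n) : Fin n × Fin n := (c e.1.1, c e.1.2)

/-- Labels of the product basis, for systems all of dimension `n`. -/
abbrev Labels (n : ℕ) : Type := (Σ e : Edge n, (completeNetwork n).sources e) → Fin n

theorem star_colorState {n : ℕ} (i : Fin n)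
    (x : ∀ _ : {e // i ∈ (completeNetwork n).sources e}, Fin n) :
    star (colorState n i x) = colorState n i x := by
  rw [colorState, star_mul', star_sum]
  refine congrArg₂ _ (by simp) (Finset.sum_congr rfl fun c _ => ?_)
  by_cases h : ∀ e, x e = c
  · rw [if_pos h, star_one]
  · rw [if_neg h, star_zero]

theorem prod_colorState {n : ℕ} (y : Labels n) :
    ∏ i, colorState n i (fun j => y ⟨j.1, ⟨i, j.2⟩⟩) = (1 / (Real.sqrt n : ℂ)) ^ n *
      ∑ c : Fin n → Fin n, if y = fun e => c e.2 then 1 else 0 := by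
  simp only [colorState]
  rw [Finset.prod_mul_distrib, Finset.prod_const, Finset.card_univ, Fintype.card_fin,
    Finset.prod_univ_sum, Fintype.piFinset_univ]
  congr 1
  refine Finset.sum_congr rfl fun c _ => ?_
  rw [Finset.prod_ite_zero]
  simp only [Finset.prod_const_one]
  refine if_congr ⟨fun h => ?_, fun h => ?_⟩ rfl rfl
  · funext ⟨e, i, hi⟩
    exact h i (Finset.mem_univ _) ⟨e, hi⟩
  · rintro i - ⟨e, hi⟩
    rw [h]

/-- The global state is supported on labels given by one color per source and every projection has
rank one, so the trace is the squared modulus of a sum over colorings. -/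
theorem colorStrategy_dist {n : ℕ} (hn : 2 ≤ n) (W : MeasurementParams n) (a : ∀ e, Outcome n e) :
    (colorStrategy hn W).dist a =
      (1 / (n : ℝ)) ^ n * ‖∑ c : Fin n → Fin n, ∏ e, W.basisVector e (a e) (e.colors c)‖ ^ 2 := by
  let pr (y : Labels n) (e : Edge n) : Fin n × Fin n := receivedPair e fun i => y ⟨e, i⟩
  let ψ (y : Labels n) : ℂ := ∏ i, colorState n i (fun j => y ⟨j.1, ⟨i, j.2⟩⟩)
  let G (x y : Labels n) : ℂ := ∏ e, W.projection e (a e) (fun i => x ⟨e, i⟩) (fun i => y ⟨e, i⟩)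
  have hdist : (colorStrategy hn W).dist a =
      (Matrix.trace (Matrix.vecMulVec ψ (star ψ) * Matrix.of G)).re := rfl
  have hG (x y : Labels n) : G y x =
      (∏ e, W.basisVector e (a e) (pr y e)) * star (∏ e, W.basisVector e (a e) (pr x e)) := by
    rw [star_prod, ← Finset.prod_mul_distrib]
    simp only [G, pr, MeasurementParams.projection, Matrix.submatrix_apply, Matrix.vecMulVec_apply,
      Pi.star_apply]
  have hs (y : Labels n) : star (ψ y) = ψ y := by
    simp only [ψ, star_prod, star_colorState]
  have hB : ∑ y, ψ y * ∏ e, W.basisVector e (a e) (pr y e) =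
      (1 / (Real.sqrt n : ℂ)) ^ n * ∑ c : Fin n → Fin n,
        ∏ e, W.basisVector e (a e) (e.colors c) := by
    simp only [ψ, prod_colorState, mul_assoc, ← Finset.mul_sum, Finset.sum_mul, ite_mul, one_mul,
      zero_mul]
    refine congrArg _ ?_
    rw [Finset.sum_comm]
    refine Finset.sum_congr rfl fun c _ => ?_
    rw [Finset.sum_ite_eq' Finset.univ, if_pos (Finset.mem_univ _)]
    rfl
  set B := ∑ y, ψ y * ∏ e, W.basisVector e (a e) (pr y e) with hBdef
  have htr : Matrix.trace (Matrix.vecMulVec ψ (star ψ) * Matrix.of G) = star B * B := by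
    simp only [hBdef, star_sum, Finset.sum_mul, Finset.mul_sum, Matrix.trace, Matrix.diag_apply,
      Matrix.mul_apply, Matrix.vecMulVec_apply, Matrix.of_apply, hG, Pi.star_apply]
    rw [Finset.sum_comm]
    refine Finset.sum_congr rfl fun x _ => Finset.sum_congr rfl fun y _ => ?_
    simp only [star_mul', hs]
    ring
  have h2 : star B * B = ((‖B‖ ^ 2 : ℝ) : ℂ) := by
    rw [Complex.star_def, Complex.conj_mul']
    push_cast; rfl
  rw [hdist, htr, h2, Complex.ofReal_re, hB, norm_mul, mul_pow]
  congr 1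
  rw [norm_pow, ← pow_mul, mul_comm n 2, pow_mul]
  congr 1
  rw [norm_div, norm_one, Complex.norm_real, Real.norm_eq_abs, div_pow, sq_abs,
    Real.sq_sqrt (Nat.cast_nonneg n), one_pow]

theorem Edge.exists_mem_ne {n : ℕ} (hn : 3 ≤ n) (e₀ : Edge n) (v : Fin n) :
    ∃ e : Edge n, e ≠ e₀ ∧ (e.1.1 = v ∨ e.1.2 = v) := by
  -- The new neighbor `w` of `v` must avoid `v` and, if `v` is an end of `e₀`, the other end.
  obtain ⟨w, hw⟩ : ∃ w, w ∉ ({v, if e₀.1.1 = v then e₀.1.2 else e₀.1.1} : Finset (Fin n)) := by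
    by_contra! h
    have h1 := Finset.card_le_card (fun x _ => h x : Finset.univ ⊆ _)
    have h2 := h1.trans Finset.card_le_two
    rw [Finset.card_univ, Fintype.card_fin] at h2
    omega
  simp only [Finset.mem_insert, Finset.mem_singleton, not_or] at hw
  rcases lt_or_gt_of_ne hw.1 with h | h
  · refine ⟨⟨(w, v), h⟩, ?_, Or.inr rfl⟩
    rintro rfl
    have : w ≠ v := hw.1
    simp [this] at hw
  · refine ⟨⟨(v, w), h⟩, ?_, Or.inl rfl⟩
    rintro rfl
    simp at hw

/-- Marginals of the quantum distribution for events that leave at most one party a superposition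
of colors. -/
theorem colorStrategy_sum_dist {n : ℕ} (hn : 3 ≤ n) (hn' : 2 ≤ n) (W : MeasurementParams n)
    (T : ∀ e, Finset (Outcome n e)) (e₀ : Edge n)
    (hT : ∀ e ≠ e₀, ∀ p q, p ≠ q →
      ∑ α ∈ T e, W.basisVector e α p * star (W.basisVector e α q) = 0) :
    ∑ a ∈ Fintype.piFinset T, (colorStrategy hn' W).dist a =
      (1 / (n : ℝ)) ^ n *
        ∑ c : Fin n → Fin n, ∏ e, ∑ α ∈ T e, ‖W.basisVector e α (e.colors c)‖ ^ 2 := by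
  simp only [colorStrategy_dist, ← Finset.mul_sum]
  congr 1
  apply Complex.ofReal_injective
  push_cast
  simp only [← Complex.mul_conj', map_sum, map_prod, Finset.sum_mul_sum]
  rw [Finset.sum_comm]
  refine Finset.sum_congr rfl fun c _ => ?_
  -- The squared modulus is a double sum over colorings. If they differ at `v`, some edge at `v`
  -- other than `e₀` has a vanishing off-diagonal factor.
  rw [Finset.sum_comm, Finset.sum_eq_single c]
  · simp only [← Finset.prod_mul_distrib]
    rw [← Finset.prod_univ_sum T fun e α =>
      W.basisVector e α (e.colors c) * (starRingEnd ℂ) (W.basisVector e α (e.colors c))]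
  · intro c' _ hc'
    simp only [← Finset.prod_mul_distrib]
    rw [← Finset.prod_univ_sum T fun e α =>
      W.basisVector e α (e.colors c) * (starRingEnd ℂ) (W.basisVector e α (e.colors c'))]
    obtain ⟨v, hv⟩ : ∃ v, c v ≠ c' v := by
      by_contra! h
      exact hc' (funext h).symm
    obtain ⟨e, he, hev⟩ := Edge.exists_mem_ne hn e₀ v
    refine Finset.prod_eq_zero (Finset.mem_univ e) (hT e he _ _ ?_)
    rintro h
    simp only [Prod.mk.injEq] at h
    rcases hev with rfl | rfl
    · exact hv h.1
    · exact hv h.2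
  · simp

theorem MeasurementParams.sum_norm_basisVector {n : ℕ} (W : MeasurementParams n) (e : Edge n)
    (p : Fin n × Fin n) : ∑ α, ‖W.basisVector e α p‖ ^ 2 = 1 := by
  have h := W.sum_basisVector_mul e p p
  rw [if_pos rfl] at h
  apply Complex.ofReal_injective
  push_cast
  rw [← h]
  exact Finset.sum_congr rfl fun α _ => (Complex.mul_conj' _).symm

/-! ### Functions of independent messages -/

section Average

variable {I : Type} [Fintype I] [DecidableEq I] {Ω : I → Type u} [∀ i, MeasurableSpace (Ω i)]
  (μ : ∀ i, Measure (Ω i)) [∀ i, IsProbabilityMeasure (μ i)]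

/-- It suffices to test boxes, where the discarded coordinate has total mass one. This resampling is
what gives `average` its Fubini and almost-everywhere properties. -/
theorem measurePreserving_update (k : I) :
    MeasurePreserving (fun q : (∀ i, Ω i) × Ω k => Function.update q.1 k q.2)
      ((Measure.pi μ).prod (μ k)) (Measure.pi μ) := by
  refine ⟨measurable_update', (Measure.pi_eq fun t ht => ?_).symm⟩
  rw [Measure.map_apply measurable_update' (MeasurableSet.univ_pi ht)]
  have h : (fun q : (∀ i, Ω i) × Ω k => Function.update q.1 k q.2) ⁻¹' Set.univ.pi t =
      (Set.univ.pi (Function.update t k Set.univ)) ×ˢ t k := by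
    ext ⟨s, z⟩
    simp only [Set.mem_preimage, Set.mem_univ_pi, Set.mem_prod]
    constructor
    · intro h
      refine ⟨fun i => ?_, by simpa using h k⟩
      by_cases hi : i = k
      · subst hi; simp
      · simpa [hi] using h i
    · rintro ⟨h1, h2⟩ i
      by_cases hi : i = k
      · subst hi; simpa using h2
      · simpa [hi] using h1 i
  rw [h, Measure.prod_prod, Measure.pi_pi, ← Finset.mul_prod_erase _ _ (Finset.mem_univ k),
    ← Finset.mul_prod_erase _ (fun i => μ i (t i)) (Finset.mem_univ k)]
  simp only [Function.update_self, measure_univ, one_mul]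
  rw [mul_comm]
  refine congrArg _ (Finset.prod_congr rfl fun i hi => ?_)
  rw [Function.update_of_ne (Finset.ne_of_mem_erase hi)]

/-- The expectation over the message of source `k`, the other messages being fixed. -/
noncomputable def average (k : I) (Φ : (∀ i, Ω i) → ℝ) (s : ∀ i, Ω i) : ℝ :=
  ∫ z, Φ (Function.update s k z) ∂μ k

variable {μ}

theorem measurable_average (k : I) {Φ : (∀ i, Ω i) → ℝ} (hΦ : Measurable Φ) :
    Measurable (average μ k Φ) := by
  have h : StronglyMeasurable fun q : (∀ i, Ω i) × Ω k => Φ (Function.update q.1 k q.2) :=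
    (hΦ.comp measurable_update').stronglyMeasurable
  exact h.integral_prod_right.measurable

theorem integral_average (k : I) {Φ : (∀ i, Ω i) → ℝ} (hΦ : Measurable Φ)
    (hint : Integrable Φ (Measure.pi μ)) :
    ∫ s, average μ k Φ s ∂Measure.pi μ = ∫ s, Φ s ∂Measure.pi μ := by
  have hmp := measurePreserving_update μ k
  have h1 := hmp.integrable_comp_of_integrable hint
  have h2 := integral_prod _ h1
  have h3 := integral_map (μ := (Measure.pi μ).prod (μ k)) hmp.measurable.aemeasurable (f := Φ)
    hΦ.aestronglyMeasurable
  rw [hmp.map_eq] at h3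
  rw [h3]
  exact h2.symm

theorem average_congr_ae (k : I) {Φ Ψ : (∀ i, Ω i) → ℝ} (h : Φ =ᵐ[Measure.pi μ] Ψ) :
    average μ k Φ =ᵐ[Measure.pi μ] average μ k Ψ := by
  have h1 := (measurePreserving_update μ k).quasiMeasurePreserving.ae h
  filter_upwards [Measure.ae_ae_of_ae_prod h1] with s hs
  exact integral_congr_ae hs

theorem average_mem_Icc (k : I) {Φ : (∀ i, Ω i) → ℝ} (h : ∀ s, Φ s ∈ Set.Icc 0 1)
    (s : ∀ i, Ω i) : average μ k Φ s ∈ Set.Icc 0 1 := by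
  refine ⟨integral_nonneg fun z => (h _).1, ?_⟩
  refine (integral_mono_of_nonneg (.of_forall fun z => (h _).1) (integrable_const (1 : ℝ))
    (.of_forall fun z => (h _).2)).trans ?_
  simp

theorem average_mul_left (k : I) {F : (∀ i, Ω i) → ℝ} {A : Set I} (hF : DependsOn F A)
    (hk : k ∉ A) (Φ : (∀ i, Ω i) → ℝ) :
    average μ k (fun s => F s * Φ s) = fun s => F s * average μ k Φ s := by
  funext s
  have h (z : Ω k) : F (Function.update s k z) = F s := hF fun i hi => by
    rw [Function.update_of_ne]
    rintro rfl
    exact hk hi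
  simp only [average, h, integral_const_mul]

theorem dependsOn_average (k : I) {F : (∀ i, Ω i) → ℝ} {A : Set I} (hF : DependsOn F A) :
    DependsOn (average μ k F) (A \ {k}) := by
  intro s t hst
  simp only [average]
  congr 1
  funext z
  refine hF fun i hi => ?_
  by_cases hik : i = k
  · subst hik; simp
  · rw [Function.update_of_ne hik, Function.update_of_ne hik]
    exact hst i ⟨hi, hik⟩

theorem average_eq_integral (k : I) {F : (∀ i, Ω i) → ℝ} (hF : DependsOn F {k})
    (hm : Measurable F) (hint : Integrable F (Measure.pi μ)) (s : ∀ i, Ω i) :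
    average μ k F s = ∫ t, F t ∂Measure.pi μ := by
  have h (t : ∀ i, Ω i) : average μ k F t = average μ k F s :=
    dependsOn_average k hF fun i hi => absurd hi.1 hi.2
  rw [← integral_average k hm hint]
  simp [h]

/-- Functions of disjoint sets of messages are independent. -/
theorem integral_mul_of_dependsOn {F G : (∀ i, Ω i) → ℝ} {A B : Finset I} (hAB : Disjoint A B)
    (hF : DependsOn F A) (hG : DependsOn G B) (hFm : Measurable F) (hGm : Measurable G) :
    ∫ s, F s * G s ∂Measure.pi μ =
      (∫ s, F s ∂Measure.pi μ) * ∫ s, G s ∂Measure.pi μ := by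
  have hne : Nonempty (∀ i, Ω i) := ⟨fun i => (nonempty_of_isProbabilityMeasure (μ i)).some⟩
  obtain ⟨s₀⟩ := hne
  -- Filling the coordinates outside `T` with `s₀` writes a function of the messages in `T` as a
  -- composite with restriction to `T`, the form in which independence of disjoint blocks applies.
  let ext (T : Finset I) (r : ∀ i : T, Ω i) (i : I) : Ω i := if h : i ∈ T then r ⟨i, h⟩ else s₀ i
  have hext (T : Finset I) : Measurable (ext T) := by
    refine measurable_pi_lambda _ fun i => ?_
    by_cases h : i ∈ T
    · simp only [ext, dif_pos h]
      exact measurable_pi_apply _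
    · simp only [ext, dif_neg h]
      exact measurable_const
  have hrest {H : (∀ i, Ω i) → ℝ} {T : Finset I} (hH : DependsOn H T) :
      H = (H ∘ ext T) ∘ fun s (i : T) => s i := by
    funext s
    refine hH fun i hi => ?_
    simp only [ext, dif_pos (Finset.mem_coe.mp hi)]
  have hind : ProbabilityTheory.iIndepFun (fun i (s : ∀ i, Ω i) => s i) (Measure.pi μ) :=
    ProbabilityTheory.iIndepFun_pi (X := fun i (x : Ω i) => x) fun i => aemeasurable_id
  have h1 := (hind.indepFun_finset A B hAB fun i => measurable_pi_apply i).comp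
    (hFm.comp (hext A)) (hGm.comp (hext B))
  rw [← hrest hF, ← hrest hG] at h1
  exact h1.integral_fun_mul_eq_mul_integral hFm.aestronglyMeasurable hGm.aestronglyMeasurable

theorem integrable_of_mem_Icc {α : Type*} [MeasurableSpace α] {ν : Measure α} [IsFiniteMeasure ν]
    {f : α → ℝ} {a b : ℝ} (hm : Measurable f) (h : ∀ x, f x ∈ Set.Icc a b) : Integrable f ν :=
  Integrable.of_mem_Icc a b hm.aemeasurable (.of_forall h)

theorem integral_combination {α : Type*} [MeasurableSpace α] {ν : Measure α} {f g h : α → ℝ}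
    (hf : Integrable f ν) (hg : Integrable g ν) (hh : Integrable h ν) (a b : ℝ) :
    ∫ x, (a * f x + b * g x + h x) ∂ν = a * ∫ x, f x ∂ν + b * ∫ x, g x ∂ν + ∫ x, h x ∂ν := by
  have h1 := integral_add (f := fun x => a * f x + b * g x)
    ((hf.const_mul a).add (hg.const_mul b)) hh
  rw [h1, integral_add (hf.const_mul a) (hg.const_mul b), integral_const_mul, integral_const_mul]

/-- Cauchy–Schwarz combined with a² ≤ a and b² ≤ b. It is the discriminant condition for t²∫a -
2t∫ab + ∫b, whose integrand is (ta - b)² + t²a(1 - a) + b(1 - b). -/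
theorem sq_integral_mul_le {α : Type*} [MeasurableSpace α] {ν : Measure α} [IsFiniteMeasure ν]
    {a b : α → ℝ} (ha : Measurable a) (hb : Measurable b) (ha' : ∀ x, a x ∈ Set.Icc 0 1)
    (hb' : ∀ x, b x ∈ Set.Icc 0 1) :
    (∫ x, a x * b x ∂ν) ^ 2 ≤ (∫ x, a x ∂ν) * ∫ x, b x ∂ν := by
  have hai := integrable_of_mem_Icc (ν := ν) ha ha'
  have hbi := integrable_of_mem_Icc (ν := ν) hb hb'
  have hab : Integrable (fun x => a x * b x) ν := by
    refine integrable_of_mem_Icc (a := 0) (b := 1) (ha.mul hb) fun x => ⟨?_, ?_⟩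
    · exact mul_nonneg (ha' x).1 (hb' x).1
    · exact mul_le_one₀ (ha' x).2 (hb' x).1 (hb' x).2
  have key (t : ℝ) : 0 ≤ (∫ x, a x ∂ν) * (t * t) + (-2 * ∫ x, a x * b x ∂ν) * t + ∫ x, b x ∂ν := by
    have h : 0 ≤ ∫ x, (t * t * a x + (-2 * t) * (a x * b x) + b x) ∂ν := by
      refine integral_nonneg fun x => ?_
      have h1 := ha' x
      have h2 := hb' x
      have : 0 ≤ (t * a x - b x) ^ 2 + t ^ 2 * (a x * (1 - a x)) + b x * (1 - b x) := by
        have := mul_nonneg h1.1 (sub_nonneg.mpr h1.2)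
        have := mul_nonneg h2.1 (sub_nonneg.mpr h2.2)
        positivity
      simp only [Pi.zero_apply]
      linarith
    rw [integral_combination hai hab hbi] at h
    linarith
  have := discrim_le_zero key
  simp only [discrim] at this
  linarith

theorem ae_eq_of_le_of_integral_eq {α : Type*} [MeasurableSpace α] {ν : Measure α} {f g : α → ℝ}
    (hf : Integrable f ν) (hg : Integrable g ν) (hle : ∀ x, f x ≤ g x)
    (h : ∫ x, f x ∂ν = ∫ x, g x ∂ν) : f =ᵐ[ν] g :=
  (integral_eq_iff_of_ae_le hf hg (.of_forall hle)).mp h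

theorem mul_mem_Icc_zero_one {x y : ℝ} (hx : x ∈ Set.Icc (0 : ℝ) 1) (hy : y ∈ Set.Icc (0 : ℝ) 1) :
    x * y ∈ Set.Icc (0 : ℝ) 1 :=
  ⟨mul_nonneg hx.1 hy.1, mul_le_one₀ hx.2 hy.1 hy.2⟩

/-- The equality case of the Finner inequality in the triangle. -/
theorem triangle_finner_equality {f g h : (∀ i, Ω i) → ℝ} {i j k : I} (hij : i ≠ j) (hik : i ≠ k)
    (hjk : j ≠ k) (hf : Measurable f) (hg : Measurable g) (hh : Measurable h)
    (hf' : ∀ s, f s ∈ Set.Icc 0 1) (hg' : ∀ s, g s ∈ Set.Icc 0 1) (hh' : ∀ s, h s ∈ Set.Icc 0 1)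
    (hfd : DependsOn f {i, j}) (hgd : DependsOn g {j, k}) (hhd : DependsOn h {i, k})
    {p : ℝ} (hp : 0 < p) (ef : ∫ s, f s ∂Measure.pi μ = p ^ 2)
    (eg : ∫ s, g s ∂Measure.pi μ = p ^ 2) (eh : ∫ s, h s ∂Measure.pi μ = p ^ 2)
    (efgh : ∫ s, f s * (g s * h s) ∂Measure.pi μ = p ^ 3) :
    (∀ᵐ s ∂Measure.pi μ, f s ^ 2 = f s) ∧
      ∀ᵐ s ∂Measure.pi μ, f s = average μ k g s * average μ k h s / p ^ 2 := by
  have hgh' : ∀ s, g s * h s ∈ Set.Icc (0 : ℝ) 1 := fun s => mul_mem_Icc_zero_one (hg' s) (hh' s)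
  set u := average μ k (fun s => g s * h s) with hu
  have um : Measurable u := measurable_average k (hg.mul hh)
  have u01 : ∀ s, u s ∈ Set.Icc 0 1 := average_mem_Icc k hgh'
  set G := average μ k g with hG
  set H := average μ k h with hH
  have Gm : Measurable G := measurable_average k hg
  have Hm : Measurable H := measurable_average k hh
  have G01 : ∀ s, G s ∈ Set.Icc 0 1 := average_mem_Icc k hg'
  have H01 : ∀ s, H s ∈ Set.Icc 0 1 := average_mem_Icc k hh'
  -- Cauchy–Schwarz in the message of `k` alone, the other messages being fixed.
  have hle (s) : u s ^ 2 ≤ G s * H s := by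
    have hmu : Measurable fun z : Ω k => Function.update s k z :=
      measurable_update'.comp (measurable_const.prodMk measurable_id)
    exact sq_integral_mul_le (hg.comp hmu) (hh.comp hmu) (fun z => hg' _) fun z => hh' _
  have fi := integrable_of_mem_Icc (ν := Measure.pi μ) hf hf'
  have f2i : Integrable (fun s => f s ^ 2) (Measure.pi μ) :=
    integrable_of_mem_Icc (a := 0) (b := 1) (hf.pow_const 2) fun s => by
      rw [sq]; exact mul_mem_Icc_zero_one (hf' s) (hf' s)
  have u2i : Integrable (fun s => u s ^ 2) (Measure.pi μ) :=
    integrable_of_mem_Icc (a := 0) (b := 1) (um.pow_const 2) fun s => by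
      rw [sq]; exact mul_mem_Icc_zero_one (u01 s) (u01 s)
  have fui : Integrable (fun s => f s * u s) (Measure.pi μ) :=
    integrable_of_mem_Icc (a := 0) (b := 1) (hf.mul um) fun s =>
      mul_mem_Icc_zero_one (hf' s) (u01 s)
  have GHi : Integrable (fun s => G s * H s) (Measure.pi μ) :=
    integrable_of_mem_Icc (a := 0) (b := 1) (Gm.mul Hm) fun s =>
      mul_mem_Icc_zero_one (G01 s) (H01 s)
  have efu : ∫ s, f s * u s ∂Measure.pi μ = p ^ 3 := by
    have := integral_average (μ := μ) k (Φ := fun s => f s * (g s * h s)) (hf.mul (hg.mul hh))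
      (integrable_of_mem_Icc (a := 0) (b := 1) (hf.mul (hg.mul hh)) fun s =>
        mul_mem_Icc_zero_one (hf' s) (hgh' s))
    rw [← efgh, ← this, average_mul_left k hfd (by simp [hik.symm, hjk.symm])]
  -- After averaging over `k`, `G` depends on the message of `j` only and `H` on that of `i` only.
  have eGH : ∫ s, G s * H s ∂Measure.pi μ = p ^ 4 := by
    rw [integral_mul_of_dependsOn (A := {j}) (B := {i}) (by simpa using hij.symm) _ _ Gm Hm,
      integral_average k hg (integrable_of_mem_Icc hg hg'),
      integral_average k hh (integrable_of_mem_Icc hh hh'), eg, eh]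
    · ring
    · refine (dependsOn_average k hgd).mono ?_
      rintro x ⟨hx, hxk⟩
      simpa [show x ≠ k from hxk] using hx
    · refine (dependsOn_average k hhd).mono ?_
      rintro x ⟨hx, hxk⟩
      simpa [show x ≠ k from hxk] using hx
  have hf2le (s) : f s ^ 2 ≤ f s := by
    have := hf' s
    nlinarith [this.1, this.2]
  have I1 : ∫ s, f s ^ 2 ∂Measure.pi μ ≤ p ^ 2 := ef ▸ integral_mono f2i fi hf2le
  have I2 : ∫ s, u s ^ 2 ∂Measure.pi μ ≤ p ^ 4 := eGH ▸ integral_mono u2i GHi hle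
  -- With ∫f² ≤ p² and ∫u² ≤ p⁴ the right side is at most p⁴ - 2p⁴ + p⁴ = 0. So every inequality is
  -- an equality: f² = f, u² = GH and u = pf almost surely, whence f = f² = GH / p².
  have expand : ∫ s, (p * f s - u s) ^ 2 ∂Measure.pi μ =
      p ^ 2 * ∫ s, f s ^ 2 ∂Measure.pi μ - 2 * p * p ^ 3 + ∫ s, u s ^ 2 ∂Measure.pi μ := by
    have : (fun s => (p * f s - u s) ^ 2) =
        fun s => p ^ 2 * f s ^ 2 + -(2 * p) * (f s * u s) + u s ^ 2 := by
      funext s; ring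
    rw [this, integral_combination f2i fui u2i, efu]
    ring
  have hnn : 0 ≤ ∫ s, (p * f s - u s) ^ 2 ∂Measure.pi μ := integral_nonneg fun s => sq_nonneg _
  have hp2 : 0 < p ^ 2 := by positivity
  have E1 : ∫ s, f s ^ 2 ∂Measure.pi μ = p ^ 2 := by
    refine le_antisymm I1 ?_
    have : p ^ 2 * p ^ 2 ≤ p ^ 2 * ∫ s, f s ^ 2 ∂Measure.pi μ := by
      rw [expand] at hnn
      nlinarith
    exact le_of_mul_le_mul_left this hp2
  have E2 : ∫ s, u s ^ 2 ∂Measure.pi μ = p ^ 4 := by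
    refine le_antisymm I2 ?_
    rw [expand, E1] at hnn
    nlinarith
  have E0 : ∫ s, (p * f s - u s) ^ 2 ∂Measure.pi μ = 0 := by
    rw [expand, E1, E2]; ring
  have A1 := ae_eq_of_le_of_integral_eq f2i fi hf2le (E1.trans ef.symm)
  have A2 := ae_eq_of_le_of_integral_eq u2i GHi hle (E2.trans eGH.symm)
  have ti : Integrable (fun s => (p * f s - u s) ^ 2) (Measure.pi μ) := by
    have : (fun s => (p * f s - u s) ^ 2) =
        fun s => p ^ 2 * f s ^ 2 + -(2 * p) * (f s * u s) + u s ^ 2 := by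
      funext s; ring
    rw [this]
    exact ((f2i.const_mul _).add (fui.const_mul _)).add u2i
  have A0 := (integral_eq_zero_iff_of_nonneg (fun s => sq_nonneg (p * f s - u s)) ti).mp E0
  refine ⟨A1, ?_⟩
  filter_upwards [A0, A1, A2] with s h0 h1 h2
  have h3 : p * f s - u s = 0 := by simpa using h0
  rw [← h2, eq_div_iff hp2.ne', ← h1]
  have : u s = p * f s := by linarith
  rw [this]; ring

end Average

/-! ### Rigidity: match responses are indicators of products of message sets. -/

section Rigidity

variable {I : Type} [Fintype I] [DecidableEq I] {Ω : I → Type u} [∀ i, MeasurableSpace (Ω i)]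
  {μ : ∀ i, Measure (Ω i)} [∀ i, IsProbabilityMeasure (μ i)]

theorem exists_ne_ne (hI : 3 ≤ Fintype.card I) (i j : I) : ∃ k, i ≠ k ∧ j ≠ k := by
  by_contra! h
  have h1 : (Finset.univ : Finset I) ⊆ {i, j} := by
    intro k _
    by_cases hik : i = k
    · simp [hik]
    · simp [h k hik]
  have h2 := (Finset.card_le_card h1).trans Finset.card_le_two
  rw [Finset.card_univ] at h2
  omega

/-- Responses to pairs of messages that saturate the Finner inequality in all triangles are
products of functions of the messages. -/
theorem exists_factorization (hI : 3 ≤ Fintype.card I) {f : I → I → (∀ i, Ω i) → ℝ} {p : ℝ}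
    (hm : ∀ i j, Measurable (f i j)) (h01 : ∀ i j s, f i j s ∈ Set.Icc 0 1)
    (hd : ∀ i j, DependsOn (f i j) {i, j}) (hp : 0 < p)
    (h1 : ∀ i j, i ≠ j → ∫ s, f i j s ∂Measure.pi μ = p ^ 2)
    (h3 : ∀ i j k, i ≠ j → i ≠ k → j ≠ k →
      ∫ s, f i j s * (f j k s * f i k s) ∂Measure.pi μ = p ^ 3) :
    ∃ h : I → (∀ i, Ω i) → ℝ, (∀ i, Measurable (h i)) ∧ (∀ i s, h i s ∈ Set.Icc 0 (1 / p)) ∧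
      (∀ i, DependsOn (h i) {i}) ∧ (∀ i, ∫ s, h i s ∂Measure.pi μ = p) ∧
      (∀ i j, i ≠ j → ∀ᵐ s ∂Measure.pi μ, f i j s ^ 2 = f i j s) ∧
      ∀ i j, i ≠ j → ∀ᵐ s ∂Measure.pi μ, f i j s = h i s * h j s := by
  set g : I → I → (∀ i, Ω i) → ℝ := fun i k => average μ k (f i k) with hg
  have gm (i k) : Measurable (g i k) := measurable_average k (hm i k)
  have g01 (i k s) : g i k s ∈ Set.Icc 0 1 := average_mem_Icc k (h01 i k) s
  have gd (i k) : DependsOn (g i k) {i} := by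
    refine (dependsOn_average k (hd i k)).mono ?_
    rintro x ⟨hx, hxk⟩
    simpa [show x ≠ k from hxk] using hx
  have gint (i k) : Integrable (g i k) (Measure.pi μ) := integrable_of_mem_Icc (gm i k) (g01 i k)
  have eg (i k) (hik : i ≠ k) : ∫ s, g i k s ∂Measure.pi μ = p ^ 2 := by
    rw [← h1 i k hik]
    exact integral_average k (hm i k) (integrable_of_mem_Icc (hm i k) (h01 i k))
  have tri (i j k) (hij : i ≠ j) (hik : i ≠ k) (hjk : j ≠ k) :=
    triangle_finner_equality (μ := μ) hij hik hjk (hm i j) (hm j k) (hm i k) (h01 i j) (h01 j k)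
      (h01 i k) (hd i j) (hd j k) (hd i k) hp (h1 i j hij) (h1 j k hjk) (h1 i k hik)
      (h3 i j k hij hik hjk)
  have hp2 : p ^ 2 ≠ 0 := by positivity
  -- Average f_ij = g_ik g_jk / p² over the message of `j`: since ∫ g_jk = p², the result g_ij
  -- equals g_ik. The averaged response of `i` thus does not depend on the neighbor.
  have geq (i j k) (hij : i ≠ j) (hik : i ≠ k) (hjk : j ≠ k) : g i j =ᵐ[Measure.pi μ] g i k := by
    have h := average_congr_ae (μ := μ) j (Φ := f i j)
      (Ψ := fun s => g i k s * (g j k s * (1 / p ^ 2))) (by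
        filter_upwards [(tri i j k hij hik hjk).2] with s hs
        rw [hs]; simp only [hg]; ring)
    rw [average_mul_left j (gd i k) (by simpa using hij.symm)] at h
    filter_upwards [h] with s hs
    change g i j s = _ at hs
    rw [hs, average_eq_integral j (fun x y hxy => by rw [gd j k hxy]) ((gm j k).mul_const _)
      ((gint j k).mul_const _), integral_mul_const, eg j k hjk]
    field_simp
  have hκ (i : I) : ∃ k, i ≠ k := (exists_ne_ne hI i i).imp fun k hk => hk.1
  choose κ hκ using hκ
  have geq' (i k) (hik : i ≠ k) : g i k =ᵐ[Measure.pi μ] g i (κ i) := by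
    by_cases h : k = κ i
    · rw [h]
    · exact geq i k (κ i) hik (hκ i) h
  -- Any neighbor `κ i` serves; dividing by `p` distributes the factor 1 / p² over the two ends.
  refine ⟨fun i s => g i (κ i) s / p, fun i => (gm _ _).div_const _, fun i s => ?_, ?_, ?_, ?_, ?_⟩
  · exact ⟨div_nonneg (g01 _ _ s).1 hp.le, div_le_div_of_nonneg_right (g01 _ _ s).2 hp.le⟩
  · intro i x y hxy
    simp only [gd i (κ i) hxy]
  · intro i
    rw [integral_div, eg i _ (hκ i)]
    field_simp
  · intro i j hij
    obtain ⟨k, hik, hjk⟩ := exists_ne_ne hI i j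
    exact (tri i j k hij hik hjk).1
  · intro i j hij
    obtain ⟨k, hik, hjk⟩ := exists_ne_ne hI i j
    filter_upwards [(tri i j k hij hik hjk).2, geq' i k hik, geq' j k hjk] with s hs h4 h5
    rw [hs, ← h4, ← h5]
    simp only [hg]
    field_simp

/-- Rigidity for a single color. -/
theorem exists_color_sets (hI : 3 ≤ Fintype.card I) {f : I → I → (∀ i, Ω i) → ℝ} {p : ℝ}
    (hm : ∀ i j, Measurable (f i j)) (h01 : ∀ i j s, f i j s ∈ Set.Icc 0 1)
    (hd : ∀ i j, DependsOn (f i j) {i, j}) (hp : 0 < p)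
    (h1 : ∀ i j, i ≠ j → ∫ s, f i j s ∂Measure.pi μ = p ^ 2)
    (h2 : ∀ i j k, i ≠ j → i ≠ k → j ≠ k → ∫ s, f i j s * f i k s ∂Measure.pi μ = p ^ 3)
    (h3 : ∀ i j k, i ≠ j → i ≠ k → j ≠ k →
      ∫ s, f i j s * (f j k s * f i k s) ∂Measure.pi μ = p ^ 3) :
    ∃ A : ∀ i, Set (Ω i), (∀ i, MeasurableSet (A i)) ∧ (∀ i, (μ i).real (A i) = p) ∧
      ∀ i j, i ≠ j → ∀ᵐ s ∂Measure.pi μ,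
        (s i ∈ A i ∧ s j ∈ A j → f i j s = 1) ∧ (¬ (s i ∈ A i ∧ s j ∈ A j) → f i j s = 0) := by
  obtain ⟨h, hmeas, hb, hdep, hint, hidem, hfac⟩ :=
    exists_factorization hI hm h01 hd hp h1 h3
  have hb2 (i s) : h i s ^ 2 ∈ Set.Icc 0 ((1 / p) ^ 2) :=
    ⟨sq_nonneg _, pow_le_pow_left₀ (hb i s).1 (hb i s).2 2⟩
  have hi (i) : Integrable (h i) (Measure.pi μ) := integrable_of_mem_Icc (hmeas i) (hb i)
  have hi2 (i) : Integrable (fun s => h i s ^ 2) (Measure.pi μ) :=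
    integrable_of_mem_Icc ((hmeas i).pow_const 2) (hb2 i)
  have hdep2 (i) : DependsOn (fun s => h i s ^ 2) {i} := fun x y hxy => by
    simp only [hdep i hxy]
  -- The path j - i - k has ∫ f_ij f_ik = ∫ h_i² ∫ h_j ∫ h_k, which is p³ while the last two factors
  -- give p².
  have e2 (i) : ∫ s, h i s ^ 2 ∂Measure.pi μ = p := by
    obtain ⟨j, hij, -⟩ := exists_ne_ne hI i i
    obtain ⟨k, hik, hjk⟩ := exists_ne_ne hI i j
    have e := h2 i j k hij hik hjk
    have e' : ∫ s, f i j s * f i k s ∂Measure.pi μ =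
        ∫ s, h i s ^ 2 * (h j s * h k s) ∂Measure.pi μ := by
      refine integral_congr_ae ?_
      filter_upwards [hfac i j hij, hfac i k hik] with s hs hs'
      rw [hs, hs']; ring
    rw [e', integral_mul_of_dependsOn (A := {i}) (B := {j, k}) (by simp [hij, hik])
      (by simpa using hdep2 i) (G := fun s => h j s * h k s) _ ((hmeas i).pow_const 2)
      ((hmeas j).mul (hmeas k)),
      integral_mul_of_dependsOn (A := {j}) (B := {k}) (by simpa using hjk)
      (by simpa using hdep j) (by simpa using hdep k) (hmeas j) (hmeas k), hint, hint] at e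
    · have hpp : p * p ≠ 0 := by positivity
      apply mul_right_cancel₀ hpp
      rw [e]; ring
    · intro x y hxy
      simp only
      rw [hdep j (x := x) (y := y) fun a ha => hxy a (by simp [show a = j from ha]),
        hdep k (x := x) (y := y) fun a ha => hxy a (by simp [show a = k from ha])]
  -- Idempotence reads h_i² h_j² = h_i h_j. Averaging over `j`, where h_j and h_j² have the same
  -- mean p, leaves h_i² = h_i.
  have hval (i) : ∀ᵐ s ∂Measure.pi μ, h i s = 0 ∨ h i s = 1 := by
    obtain ⟨j, hij, -⟩ := exists_ne_ne hI i i
    have e : (fun s => h i s ^ 2 * h j s ^ 2) =ᵐ[Measure.pi μ] fun s => h i s * h j s := by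
      filter_upwards [hfac i j hij, hidem i j hij] with s hs hs'
      rw [hs] at hs'
      rw [← hs']; ring
    have e' := average_congr_ae (μ := μ) j e
    rw [average_mul_left j (hdep2 i) (by simpa using hij.symm),
      average_mul_left j (hdep i) (by simpa using hij.symm)] at e'
    filter_upwards [e'] with s hs
    rw [average_eq_integral j (hdep2 j) ((hmeas j).pow_const 2) (hi2 j),
      average_eq_integral j (hdep j) (hmeas j) (hi j), e2, hint] at hs
    have h4 := mul_right_cancel₀ hp.ne' hs
    have h5 : h i s * (h i s - 1) = 0 := by linarith
    rcases mul_eq_zero.mp h5 with h6 | h6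
    · exact Or.inl h6
    · exact Or.inr (by linarith)
  -- `h i` depends on message `i` only, so arbitrary fixed values elsewhere turn it into a function
  -- on `Ω i`.
  let s₀ : ∀ i, Ω i := fun i => (nonempty_of_isProbabilityMeasure (μ i)).some
  have hupd (i) (s : ∀ i, Ω i) : h i (Function.update s₀ i (s i)) = h i s :=
    hdep i fun x hx => by
      obtain rfl : x = i := hx
      simp
  let A (i : I) : Set (Ω i) := {x | h i (Function.update s₀ i x) = 1}
  have hA (i) : MeasurableSet (A i) :=
    (hmeas i).comp (measurable_update'.comp (measurable_const.prodMk measurable_id))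
      (measurableSet_singleton 1)
  have hmemA (i) (s : ∀ i, Ω i) : s i ∈ A i ↔ h i s = 1 := by
    rw [← hupd i s]; rfl
  refine ⟨A, hA, fun i => ?_, fun i j hij => ?_⟩
  · have hmp := measurePreserving_eval μ i
    rw [← hmp.measureReal_preimage (hA i).nullMeasurableSet, ← hint i,
      ← integral_indicator_one (hmp.measurable (hA i))]
    refine integral_congr_ae ?_
    filter_upwards [hval i] with s hs
    by_cases hs1 : h i s = 1
    · rw [Set.indicator_of_mem (show s ∈ Function.eval i ⁻¹' A i from (hmemA i s).mpr hs1), hs1]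
      rfl
    · rw [Set.indicator_of_notMem (s := Function.eval i ⁻¹' A i) fun hh => hs1 ((hmemA i s).mp hh),
        hs.resolve_right hs1]
  · filter_upwards [hfac i j hij, hval i, hval j] with s hs hi hj
    rw [hmemA, hmemA, hs]
    rcases hi with hi | hi <;> rcases hj with hj | hj <;> simp [hi, hj]

end Rigidity

/-! ### Classical strategies that simulate the quantum distribution -/

namespace Edge

variable {n : ℕ}

/-- The edge with ends `i` and `j`. -/
def between (i j : Fin n) (h : i ≠ j) : Edge n :=
  if hlt : i < j then ⟨(i, j), hlt⟩ else ⟨(j, i), lt_of_le_of_ne (not_lt.mp hlt) h.symm⟩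

theorem between_self (e : Edge n) : between e.1.1 e.1.2 (ne_of_lt e.2) = e := dif_pos e.2

theorem mem_ends_between {i j : Fin n} (h : i ≠ j) (v : Fin n) :
    (v = (between i j h).1.1 ∨ v = (between i j h).1.2) ↔ v = i ∨ v = j := by
  unfold between
  split_ifs
  · rfl
  · exact or_comm

theorem colors_between {i j : Fin n} (h : i ≠ j) (c : Fin n → Fin n) (d : Fin n) :
    (between i j h).colors c = (d, d) ↔ c i = d ∧ c j = d := by
  unfold between colors
  split_ifs
  · simp
  · simp [and_comm]

theorem forall_mem_sources (e : Edge n) (q : Fin n → Prop) :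
    (∀ i ∈ (completeNetwork n).sources e, q i) ↔ q e.1.1 ∧ q e.1.2 := by
  simp [completeNetwork]

theorem ne_between_of_not_mem {e : Edge n} {i j : Fin n} (h : i ≠ j) (v : Fin n)
    (hv : v = e.1.1 ∨ v = e.1.2) (hi : v ≠ i) (hj : v ≠ j) : e ≠ between i j h := by
  rintro rfl
  rcases (mem_ends_between h v).mp hv with h | h
  · exact hi h
  · exact hj h

theorem between_ne_between {i j k l : Fin n} (hij : i ≠ j) (hkl : k ≠ l) (hk : i ≠ k)
    (hl : i ≠ l) : between i j hij ≠ between k l hkl :=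
  ne_between_of_not_mem hkl i ((mem_ends_between hij i).mpr (Or.inl rfl)) hk hl

end Edge

section Strategy

variable {n : ℕ} (S : ClassicalStrategy.{u} (completeNetwork n) (Outcome n))

theorem measurable_response (e : Edge n) (a : Outcome n e) :
    Measurable fun s => S.response s e a :=
  (S.measurable_resp e a).comp (Finset.measurable_restrict _)

theorem sum_response (s : ∀ i, S.Msg i) (e : Edge n) : ∑ a, S.response s e a = 1 :=
  S.sum_resp e _

theorem response_mem_Icc (s : ∀ i, S.Msg i) (e : Edge n) (a : Outcome n e) :
    S.response s e a ∈ Set.Icc (0 : ℝ) 1 := by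
  refine ⟨S.resp_nonneg e _ a, ?_⟩
  rw [← sum_response S s e]
  exact Finset.single_le_sum (fun b _ => S.resp_nonneg e _ b) (Finset.mem_univ a)

theorem dependsOn_response (e : Edge n) (a : Outcome n e) :
    DependsOn (fun s => S.response s e a) {e.1.1, e.1.2} := by
  intro s t h
  have : (completeNetwork n |>.sources e).restrict s = (completeNetwork n |>.sources e).restrict t := by
    funext ⟨i, hi⟩
    refine h i ?_
    simpa [completeNetwork] using hi
  simp only [ClassicalStrategy.response, this]

instance : IsProbabilityMeasure S.messageLaw := by
  unfold ClassicalStrategy.messageLaw; infer_instance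

theorem sum_dist_eq_integral (T : ∀ e, Finset (Outcome n e)) :
    ∑ a ∈ Fintype.piFinset T, S.dist a =
      ∫ s, ∏ e, ∑ α ∈ T e, S.response s e α ∂S.messageLaw := by
  simp only [ClassicalStrategy.dist]
  rw [← integral_finsetSum]
  · congr 1
    funext s
    rw [Finset.prod_univ_sum]
  · intro a _
    refine integrable_of_mem_Icc (a := 0) (b := 1)
      (Finset.measurable_prod _ fun e _ => measurable_response S e (a e)) fun s => ⟨?_, ?_⟩
    · exact Finset.prod_nonneg fun e _ => (response_mem_Icc S s e _).1
    · exact Finset.prod_le_one (fun e _ => (response_mem_Icc S s e _).1)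
        fun e _ => (response_mem_Icc S s e _).2

/-- Parties that are neither `e₀` nor in `F` are summed over all outputs and contribute 1. It
applies both to classical responses and to quantum weights |⟨v|c⟩|². -/
theorem prod_sum_eq_of_fixed {X : ∀ e : Edge n, Outcome n e → ℝ} (hX : ∀ e, ∑ α, X e α = 1)
    (F : Finset (Edge n)) (e₀ : Edge n) (he₀ : e₀ ∉ F) (γ : Edge n → Fin n) (α : Outcome n e₀) :
    ∏ e, ∑ β ∈ Function.update (fun e => if e ∈ F then {matchOutcome n e (γ e)} else Finset.univ)
      e₀ {α} e, X e β = X e₀ α * ∏ e ∈ F, X e (matchOutcome n e (γ e)) := by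
  rw [← Finset.mul_prod_erase _ _ (Finset.mem_univ e₀)]
  rw [Function.update_self, Finset.sum_singleton]
  congr 1
  symm
  refine Finset.prod_subset_one_on_sdiff (fun e he => ?_) (fun e he => ?_) (fun e he => ?_)
  · exact Finset.mem_erase.mpr ⟨fun h => he₀ (h ▸ he), Finset.mem_univ e⟩
  · rw [Finset.mem_sdiff, Finset.mem_erase] at he
    rw [Function.update_of_ne he.1.1, if_neg he.2, hX]
  · have hne : e ≠ e₀ := fun h => he₀ (h ▸ he)
    rw [Function.update_of_ne hne, if_pos he, Finset.sum_singleton]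

theorem norm_sq_basisVector_match (W : MeasurementParams n) (e : Edge n) (d : Fin n)
    (p : Fin n × Fin n) :
    ‖W.basisVector e (matchOutcome n e d) p‖ ^ 2 = if p = (d, d) then 1 else 0 := by
  by_cases h : p = (d, d)
  · subst h; simp [MeasurementParams.basisVector]
  · simp [MeasurementParams.basisVector, h]

variable {S}

/-- The joint probability of an arbitrary outcome of one party and color matches of others. -/
theorem integral_response_mul_prod {hn' : 2 ≤ n} (hn : 3 ≤ n) {W : MeasurementParams n}
    (hS : ∀ a, S.dist a = (colorStrategy hn' W).dist a)
    (F : Finset (Edge n)) (e₀ : Edge n) (he₀ : e₀ ∉ F) (γ : Edge n → Fin n) (α : Outcome n e₀) :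
    ∫ s, S.response s e₀ α * ∏ e ∈ F, S.response s e (matchOutcome n e (γ e)) ∂S.messageLaw =
      (1 / (n : ℝ)) ^ n * ∑ c : Fin n → Fin n, ‖W.basisVector e₀ α (e₀.colors c)‖ ^ 2 *
        ∏ e ∈ F, if e.colors c = (γ e, γ e) then 1 else 0 := by
  have h1 := sum_dist_eq_integral S (Function.update
    (fun e => if e ∈ F then {matchOutcome n e (γ e)} else Finset.univ) e₀ {α})
  simp only [hS] at h1
  rw [colorStrategy_sum_dist hn hn' W _ e₀] at h1
  · have hl (s) := prod_sum_eq_of_fixed (sum_response S s) F e₀ he₀ γ α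
    have hr (c : Fin n → Fin n) := prod_sum_eq_of_fixed
      (X := fun e β => ‖W.basisVector e β (e.colors c)‖ ^ 2)
      (fun e => W.sum_norm_basisVector e _) F e₀ he₀ γ α
    simp only [hl, hr, norm_sq_basisVector_match] at h1
    exact h1.symm
  -- Off-diagonal terms vanish at `e ≠ e₀`: a match vector has a single nonzero coordinate, and a
  -- sum over the full basis is the identity.
  · intro e he p q hpq
    rw [Function.update_of_ne he]
    split_ifs with h
    · rw [Finset.sum_singleton]
      by_cases hp : p = (γ e, γ e)
      · have hq : q ≠ (γ e, γ e) := fun hq => hpq (hp.trans hq.symm)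
        simp [MeasurementParams.basisVector, hq]
      · simp [MeasurementParams.basisVector, hp]
    · rw [W.sum_basisVector_mul, if_neg hpq]

/-- The sum over colorings factors over vertices: one in `T` contributes a factor 1 / n, a free one
contributes 1. All marginals below reduce to this count. -/
theorem mul_sum_ite_eq (hn : 0 < n) (T : Finset (Fin n)) (d : Fin n → Fin n) (x : ℝ) :
    (1 / (n : ℝ)) ^ n * ∑ c : Fin n → Fin n, (if ∀ i ∈ T, c i = d i then x else 0) =
      x * (1 / (n : ℝ)) ^ T.card := by
  have h1 : ∑ c : Fin n → Fin n, (if ∀ i ∈ T, c i = d i then x else 0) =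
      x * ∏ i : Fin n, ∑ y : Fin n, if i ∈ T then (if y = d i then (1 : ℝ) else 0) else 1 := by
    rw [Finset.prod_univ_sum, Fintype.piFinset_univ, Finset.mul_sum]
    refine Finset.sum_congr rfl fun c _ => ?_
    by_cases h : ∀ i ∈ T, c i = d i
    · rw [if_pos h, Finset.prod_eq_one, mul_one]
      intro i _
      by_cases hi : i ∈ T
      · simp [hi, h i hi]
      · simp [hi]
    · rw [if_neg h]
      push Not at h
      obtain ⟨i, hi, hne⟩ := h
      rw [Finset.prod_eq_zero (Finset.mem_univ i), mul_zero]
      simp [hi, hne]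
  have h2 : (1 / (n : ℝ)) ^ n = ∏ i : Fin n, (1 / (n : ℝ)) := by simp
  have hn0 : (n : ℝ) ≠ 0 := by positivity
  rw [h1, h2, mul_left_comm, ← Finset.prod_mul_distrib]
  congr 1
  have h3 (i : Fin n) : (1 / (n : ℝ)) * ∑ y : Fin n,
      (if i ∈ T then (if y = d i then (1 : ℝ) else 0) else 1) = if i ∈ T then 1 / (n : ℝ) else 1 := by
    split_ifs
    · simp
    · simp [hn0]
  simp only [h3]
  rw [Finset.prod_ite_mem, Finset.univ_inter, Finset.prod_const]

/-! ### Joint probabilities of color matches on small subgraphs. -/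

section Marginals

variable {hn' : 2 ≤ n} {W : MeasurementParams n}

theorem integral_match (hn : 3 ≤ n) (hS : ∀ a, S.dist a = (colorStrategy hn' W).dist a)
    {i j : Fin n} (hij : i ≠ j) (d : Fin n) :
    ∫ s, S.response s (.between i j hij) (matchOutcome n _ d) ∂S.messageLaw =
      (1 / (n : ℝ)) ^ 2 := by
  have h := integral_response_mul_prod hn hS ∅ (.between i j hij) (by simp) (fun _ => d)
    (matchOutcome n _ d)
  simp only [Finset.prod_empty, mul_one, norm_sq_basisVector_match, Edge.colors_between] at h
  have h2 := mul_sum_ite_eq (by omega : 0 < n) {i, j} (fun _ => d) 1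
  simp only [Finset.mem_insert, Finset.mem_singleton, forall_eq_or_imp, forall_eq,
    Finset.card_pair hij, one_mul] at h2
  rw [h, ← h2]

theorem integral_match_mul_match (hn : 3 ≤ n)
    (hS : ∀ a, S.dist a = (colorStrategy hn' W).dist a)
    {i j k : Fin n} (hij : i ≠ j) (hik : i ≠ k) (hjk : j ≠ k) (d d' : Fin n) :
    ∫ s, S.response s (.between i j hij) (matchOutcome n _ d) *
      S.response s (.between i k hik) (matchOutcome n _ d') ∂S.messageLaw =
      if d = d' then (1 / (n : ℝ)) ^ 3 else 0 := by
  have hne : Edge.between i j hij ∉ ({.between i k hik} : Finset (Edge n)) := by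
    rw [Finset.mem_singleton]
    exact Edge.ne_between_of_not_mem hik j ((Edge.mem_ends_between hij j).mpr (Or.inr rfl))
      hij.symm hjk
  have h := integral_response_mul_prod hn hS {.between i k hik} (.between i j hij) hne
    (fun _ => d') (matchOutcome n _ d)
  simp only [Finset.prod_singleton, norm_sq_basisVector_match, Edge.colors_between] at h
  rw [h]
  split_ifs with hd
  · subst hd
    have h2 := mul_sum_ite_eq (by omega : 0 < n) {i, j, k} (fun _ => d) 1
    rw [Finset.card_eq_three.mpr ⟨i, j, k, hij, hik, hjk, rfl⟩, one_mul] at h2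
    rw [← h2]
    congr 1
    refine Finset.sum_congr rfl fun c _ => ?_
    simp only [Finset.mem_insert, Finset.mem_singleton, forall_eq_or_imp, forall_eq]
    by_cases h1 : c i = d <;> by_cases h2 : c j = d <;> by_cases h3 : c k = d <;> simp [h1, h2, h3]
  · rw [Finset.sum_eq_zero, mul_zero]
    intro c _
    by_cases h1 : c i = d
    · have : c i ≠ d' := h1 ▸ hd
      simp [this]
    · simp [h1]

theorem integral_match_triangle (hn : 3 ≤ n)
    (hS : ∀ a, S.dist a = (colorStrategy hn' W).dist a)
    {i j k : Fin n} (hij : i ≠ j) (hik : i ≠ k) (hjk : j ≠ k) (d : Fin n) :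
    ∫ s, S.response s (.between i j hij) (matchOutcome n _ d) *
      (S.response s (.between j k hjk) (matchOutcome n _ d) *
      S.response s (.between i k hik) (matchOutcome n _ d)) ∂S.messageLaw =
      (1 / (n : ℝ)) ^ 3 := by
  have h1 : Edge.between i j hij ≠ .between i k hik :=
    Edge.ne_between_of_not_mem hik j ((Edge.mem_ends_between hij j).mpr (Or.inr rfl))
      hij.symm hjk
  have h2 : Edge.between i j hij ≠ .between j k hjk := Edge.between_ne_between hij hjk hij hik
  have h3 : Edge.between j k hjk ≠ .between i k hik :=
    Edge.between_ne_between hjk hik hij.symm hjk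
  have h := integral_response_mul_prod hn hS {.between j k hjk, .between i k hik}
    (.between i j hij) (by simp [h1, h2]) (fun _ => d) (matchOutcome n _ d)
  simp only [Finset.prod_pair h3, norm_sq_basisVector_match, Edge.colors_between] at h
  rw [h]
  have h2 := mul_sum_ite_eq (by omega : 0 < n) {i, j, k} (fun _ => d) 1
  rw [Finset.card_eq_three.mpr ⟨i, j, k, hij, hik, hjk, rfl⟩, one_mul] at h2
  rw [← h2]
  congr 1
  refine Finset.sum_congr rfl fun c _ => ?_
  simp only [Finset.mem_insert, Finset.mem_singleton, forall_eq_or_imp, forall_eq]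
  by_cases h1 : c i = d <;> by_cases h2 : c j = d <;> by_cases h3 : c k = d <;> simp [h1, h2, h3]

/-- The matches with the extra sources `k` and `l` reveal the colors `a` and `b` of the ends of `e`
without disturbing the output of `e`; four sources have prescribed colors, hence the fourth power.
-/
theorem integral_response_mul_match_mul_match (hn : 3 ≤ n)
    (hS : ∀ a, S.dist a = (colorStrategy hn' W).dist a) (e : Edge n) (α : Outcome n e)
    {k l : Fin n} (hik : e.1.1 ≠ k) (hjk : e.1.2 ≠ k) (hil : e.1.1 ≠ l) (hjl : e.1.2 ≠ l)
    (hkl : k ≠ l) (a b : Fin n) :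
    ∫ s, S.response s e α * (S.response s (.between e.1.1 k hik) (matchOutcome n _ a) *
      S.response s (.between e.1.2 l hjl) (matchOutcome n _ b)) ∂S.messageLaw =
      ‖W.basisVector e α (a, b)‖ ^ 2 * (1 / (n : ℝ)) ^ 4 := by
  have hij : e.1.1 ≠ e.1.2 := ne_of_lt e.2
  have h1 : e ≠ .between e.1.1 k hik :=
    Edge.ne_between_of_not_mem hik e.1.2 (Or.inr rfl) hij.symm hjk
  have h2 : e ≠ .between e.1.2 l hjl :=
    Edge.ne_between_of_not_mem hjl e.1.1 (Or.inl rfl) hij hil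
  have h3 : Edge.between e.1.1 k hik ≠ .between e.1.2 l hjl :=
    Edge.between_ne_between hik hjl hij hil
  have h := integral_response_mul_prod hn hS {.between e.1.1 k hik, .between e.1.2 l hjl}
    e (by simp [h1, h2]) (fun e' => if e' = .between e.1.1 k hik then a else b) α
  simp only [Finset.prod_pair h3, if_pos, if_neg h3.symm, Edge.colors_between] at h
  rw [h]
  have h2 := mul_sum_ite_eq (by omega : 0 < n) {e.1.1, e.1.2, k, l}
    (fun v => if v = e.1.1 ∨ v = k then a else b) (‖W.basisVector e α (a, b)‖ ^ 2)
  have hcard : ({e.1.1, e.1.2, k, l} : Finset (Fin n)).card = 4 := by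
    rw [Finset.card_insert_of_notMem (by simp [hij, hik, hil]),
      Finset.card_eq_three.mpr ⟨e.1.2, k, l, hjk, hjl, hkl, rfl⟩]
  rw [hcard] at h2
  rw [← h2]
  congr 1
  refine Finset.sum_congr rfl fun c _ => ?_
  simp only [Finset.mem_insert, Finset.mem_singleton, forall_eq_or_imp, forall_eq, true_or,
    or_true, if_true, hij.symm, hjk, hil.symm, hkl.symm, or_self, if_false]
  by_cases h1 : c e.1.1 = a <;> by_cases h2 : c e.1.2 = b <;> by_cases h3 : c k = a <;>
    by_cases h4 : c l = b <;> simp [h1, h2, h3, h4, Edge.colors]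

end Marginals

end Strategy

/-! ### Color functions extracted from a simulating strategy, and their consequences. -/

section ColorMatching

variable {n : ℕ} {S : ClassicalStrategy.{u} (completeNetwork n) (Outcome n)} {hn' : 2 ≤ n}
  {W : MeasurementParams n}

theorem ae_eval {q : ∀ i, S.Msg i → Prop} (h : ∀ i, ∀ᵐ x ∂S.law i, q i x) :
    ∀ᵐ s ∂S.messageLaw, ∀ i, q i (s i) :=
  ae_all_iff.mpr fun i => (measurePreserving_eval S.law i).quasiMeasurePreserving.ae (h i)

/-- A strategy that simulates the quantum distribution attaches to each color a set of messages of
each source, such that color matches are decided by these sets. -/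
theorem exists_message_sets (hn : 3 ≤ n) (hS : ∀ a, S.dist a = (colorStrategy hn' W).dist a)
    (d : Fin n) :
    ∃ A : ∀ i, Set (S.Msg i), (∀ i, MeasurableSet (A i)) ∧
      (∀ i, (S.law i).real (A i) = 1 / (n : ℝ)) ∧
      ∀ i j (hij : i ≠ j), ∀ᵐ s ∂S.messageLaw,
        (s i ∈ A i ∧ s j ∈ A j → S.response s (.between i j hij) (matchOutcome n _ d) = 1) ∧
        (¬ (s i ∈ A i ∧ s j ∈ A j) →
          S.response s (.between i j hij) (matchOutcome n _ d) = 0) := by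
  let f (i j : Fin n) (s : ∀ i, S.Msg i) : ℝ :=
    if h : i ≠ j then S.response s (.between i j h) (matchOutcome n _ d) else 0
  have hf {i j : Fin n} (h : i ≠ j) :
      f i j = fun s => S.response s (.between i j h) (matchOutcome n _ d) := by
    funext s; exact dif_pos h
  have hf0 {i j : Fin n} (h : ¬ i ≠ j) : f i j = fun _ => 0 := by
    funext s; exact dif_neg h
  have hm (i j) : Measurable (f i j) := by
    by_cases h : i ≠ j
    · rw [hf h]; exact measurable_response S _ _
    · rw [hf0 h]; exact measurable_const
  have h01 (i j s) : f i j s ∈ Set.Icc (0 : ℝ) 1 := by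
    by_cases h : i ≠ j
    · rw [hf h]; exact response_mem_Icc S s _ _
    · rw [hf0 h]; simp
  have hd (i j) : DependsOn (f i j) {i, j} := by
    by_cases h : i ≠ j
    · rw [hf h]
      refine (dependsOn_response S _ _).mono ?_
      intro v hv
      exact (Edge.mem_ends_between h v).mp hv
    · rw [hf0 h]; exact fun _ _ _ => rfl
  obtain ⟨A, hA, hA', hfA⟩ := exists_color_sets (μ := S.law) (f := f) (p := 1 / (n : ℝ))
    (by rw [Fintype.card_fin]; omega) hm h01 hd (by positivity)
    (fun i j hij => by
      rw [hf hij]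
      exact integral_match hn hS hij d)
    (fun i j k hij hik hjk => by
      rw [hf hij, hf hik]
      have := integral_match_mul_match hn hS hij hik hjk d d
      rwa [if_pos rfl] at this)
    (fun i j k hij hik hjk => by
      rw [hf hij, hf hik, hf hjk]
      exact integral_match_triangle hn hS hij hik hjk d)
  refine ⟨A, hA, hA', fun i j hij => ?_⟩
  have := hfA i j hij
  rw [hf hij] at this
  exact this

/-- Two different color matches never occur together at a common source, so the message sets of
different colors are almost disjoint; being n sets of mass 1 / n, they exhaust the messages. -/
theorem exists_isColorMatching (hn : 3 ≤ n)
    (hS : ∀ a, S.dist a = (colorStrategy hn' W).dist a) :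
    ∃ col, S.IsColorMatching (matchOutcome n) (fun _ => 1 / (n : ℝ)) col := by
  have hn0 : (n : ℝ) ≠ 0 := by positivity
  choose A hAm hAp hA using exists_message_sets hn hS
  have hdisj (i : Fin n) (d d' : Fin n) (hdd : d ≠ d') : S.law i (A d i ∩ A d' i) = 0 := by
    obtain ⟨j, hij, -⟩ := exists_ne_ne (I := Fin n) (by rw [Fintype.card_fin]; omega) i i
    obtain ⟨k, hik, hjk⟩ := exists_ne_ne (I := Fin n) (by rw [Fintype.card_fin]; omega) i j
    have h0 := integral_match_mul_match hn hS hij hik hjk d d'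
    rw [if_neg hdd, integral_eq_zero_iff_of_nonneg] at h0
    -- On this box the edges `i j` and `i k` would output matches of different colors, so it is
    -- null; its factors other than the one at `i` have positive mass.
    · let t (v : Fin n) : Set (S.Msg v) :=
        if v = i then A d v ∩ A d' v else if v = j then A d v else if v = k then A d' v else Set.univ
      have ht : S.messageLaw (Set.univ.pi t) = 0 := by
        rw [← compl_compl (Set.univ.pi t)]
        refine (mem_ae_iff (s := (Set.univ.pi t)ᶜ)).mp ?_
        filter_upwards [h0, hA d i j hij, hA d' i k hik] with s hs h1 h2 hmem
        have hi := hmem i (Set.mem_univ i)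
        have hj := hmem j (Set.mem_univ j)
        have hk := hmem k (Set.mem_univ k)
        simp only [t, if_true, if_neg hij.symm, if_neg hik.symm, if_neg hjk.symm] at hi hj hk
        rw [h1.1 ⟨hi.1, hj⟩, h2.1 ⟨hi.2, hk⟩] at hs
        simp at hs
      rw [ClassicalStrategy.messageLaw, Measure.pi_pi, Finset.prod_eq_zero_iff] at ht
      obtain ⟨v, -, hv⟩ := ht
      have hpos (d v) : S.law v (A d v) ≠ 0 := fun h => by
        have := hAp d v
        rw [Measure.real, h] at this
        have hpos : 0 < 1 / (n : ℝ) := by positivity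
        exact hpos.ne this
      by_cases hvi : v = i
      · subst hvi
        simpa [t] using hv
      · exfalso
        simp only [t, if_neg hvi] at hv
        split_ifs at hv with h1 h2
        · exact hpos _ _ hv
        · exact hpos _ _ hv
        · simp at hv
    · exact fun s => mul_nonneg (response_mem_Icc S s _ _).1 (response_mem_Icc S s _ _).1
    · exact integrable_of_mem_Icc (a := 0) (b := 1)
        ((measurable_response S _ _).mul (measurable_response S _ _)) fun s =>
        mul_mem_Icc_zero_one (response_mem_Icc S s _ _) (response_mem_Icc S s _ _)
  have huniq (i : Fin n) : ∀ᵐ x ∂S.law i, ∃! d, x ∈ A d i := by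
    have h1 : ∀ᵐ x ∂S.law i, x ∈ ⋃ d, A d i := by
      have hmeas : MeasurableSet (⋃ d, A d i) := .iUnion fun d => hAm d i
      refine mem_ae_iff.mpr ((prob_compl_eq_zero_iff hmeas).mpr ?_)
      rw [measure_iUnion₀ (fun d d' hdd => hdisj i d d' hdd) fun d => (hAm d i).nullMeasurableSet,
        tsum_fintype]
      have h2 (d : Fin n) : S.law i (A d i) = ENNReal.ofReal (1 / (n : ℝ)) := by
        rw [← hAp d i, ofReal_measureReal]
      simp only [h2]
      rw [← ENNReal.ofReal_sum_of_nonneg fun _ _ => by positivity]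
      simp [hn0]
    have h2 : ∀ᵐ x ∂S.law i, ∀ d d', d ≠ d' → ¬ (x ∈ A d i ∩ A d' i) := by
      refine ae_all_iff.mpr fun d => ae_all_iff.mpr fun d' => ?_
      by_cases hdd : d = d'
      · exact .of_forall fun _ h => absurd hdd h
      · filter_upwards [measure_eq_zero_iff_ae_notMem.mp (hdisj i d d' hdd)] with x hx _
        exact hx
    filter_upwards [h1, h2] with x hx hx'
    obtain ⟨d, hd⟩ := Set.mem_iUnion.mp hx
    refine ⟨d, hd, fun d' hd' => ?_⟩
    by_contra hne
    exact hx' d' d hne ⟨hd', hd⟩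
  classical
  let z : Fin n := ⟨0, by omega⟩
  -- The default `z` is used only on the null set of messages with no color. As a function on the
  -- finite discrete space `Fin n → Prop`, `sel` is measurable despite the choice.
  let sel (q : Fin n → Prop) : Fin n := if h : ∃ d, q d then h.choose else z
  let col (i : Fin n) (x : S.Msg i) : Fin n := sel fun d => x ∈ A d i
  have hcol (i : Fin n) : ∀ᵐ x ∂S.law i, ∀ d, col i x = d ↔ x ∈ A d i := by
    filter_upwards [huniq i] with x hx d
    have hex : ∃ d, x ∈ A d i := hx.exists
    have hsel : x ∈ A (col i x) i := by
      simp only [col, sel, dif_pos hex]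
      exact hex.choose_spec
    exact ⟨fun h => h ▸ hsel, fun h => hx.unique hsel h⟩
  refine ⟨col, fun i => ?_, fun i c => ?_, fun e => ?_⟩
  · have h1 : Measurable sel := .of_discrete
    exact h1.comp (measurable_pi_lambda _ fun d => measurableSet_setOfPred.mp (hAm d i))
  · rw [← hAp c i]
    refine measureReal_congr ?_
    filter_upwards [hcol i] with x hx
    exact propext (hx c)
  · have h1 : ∀ᵐ s ∂S.messageLaw, ∀ c, _ :=
      ae_all_iff.mpr fun c => hA c e.1.1 e.1.2 (ne_of_lt e.2)
    rw [Edge.between_self] at h1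
    filter_upwards [h1, ae_eval hcol] with s hs hs' c
    have h2 : (∀ i ∈ (completeNetwork n).sources e, col i (s i) = c) ↔
        s e.1.1 ∈ A c e.1.1 ∧ s e.1.2 ∈ A c e.1.2 := by
      rw [Edge.forall_mem_sources e fun i => col i (s i) = c, hs', hs']
    by_cases h : s e.1.1 ∈ A c e.1.1 ∧ s e.1.2 ∈ A c e.1.2
    · rw [if_pos (h2.mpr h), (hs c).1 h]
    · rw [if_neg fun hh => h (h2.mp hh), (hs c).2 h]

theorem integral_ite_one_zero {α : Type*} [MeasurableSpace α] {ν : Measure α} {q : α → Prop}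
    [DecidablePred q] (hq : MeasurableSet {x | q x}) :
    ∫ x, (if q x then (1 : ℝ) else 0) ∂ν = ν.real {x | q x} := by
  rw [← integral_indicator_one hq]
  congr 1
  funext x
  by_cases h : q x
  · rw [if_pos h, Set.indicator_of_mem (show x ∈ {x | q x} from h)]; rfl
  · rw [if_neg h, Set.indicator_of_notMem (show x ∉ {x | q x} from h)]

/-- The indicator of the event that source `i` takes color `c`. -/
def colorIndicator (col : ∀ i, S.Msg i → Fin n) (i c : Fin n) (s : ∀ i, S.Msg i) : ℝ :=
  if col i (s i) = c then 1 else 0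

variable {col : ∀ i, S.Msg i → Fin n} {p : Fin n → ℝ}

theorem colorIndicator_mem_Icc (i c : Fin n) (s : ∀ i, S.Msg i) :
    colorIndicator col i c s ∈ Set.Icc (0 : ℝ) 1 := by
  unfold colorIndicator
  split_ifs <;> simp

theorem dependsOn_colorIndicator (i c : Fin n) : DependsOn (colorIndicator col i c) {i} :=
  fun x y h => by simp only [colorIndicator, h i rfl]

variable (hCM : S.IsColorMatching (matchOutcome n) p col)
include hCM

theorem measurable_colorIndicator (i c : Fin n) : Measurable (colorIndicator col i c) :=
  .ite ((hCM.measurable_col i).comp (measurable_pi_apply i) (measurableSet_singleton c))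
    measurable_const measurable_const

theorem integral_colorIndicator (i c : Fin n) :
    ∫ s, colorIndicator col i c s ∂S.messageLaw = p c := by
  have hmp := measurePreserving_eval S.law i
  have hm : MeasurableSet {m | col i m = c} := hCM.measurable_col i (measurableSet_singleton c)
  rw [← hCM.color_law i c, ← hmp.measureReal_preimage hm.nullMeasurableSet]
  exact integral_ite_one_zero (hmp.measurable hm)

theorem ae_response_match {i j : Fin n} (hij : i ≠ j) (c : Fin n) :
    ∀ᵐ s ∂S.messageLaw, S.response s (.between i j hij) (matchOutcome n _ c) =
      colorIndicator col i c s * colorIndicator col j c s := by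
  filter_upwards [hCM.color_match (.between i j hij)] with s hs
  rw [hs c]
  have h : (∀ v ∈ (completeNetwork n).sources (.between i j hij), col v (s v) = c) ↔
      col i (s i) = c ∧ col j (s j) = c := by
    rw [Edge.forall_mem_sources _ fun v => col v (s v) = c]
    have := Edge.colors_between hij (fun v => col v (s v)) c
    simpa only [Edge.colors, Prod.mk.injEq] using this
  simp only [h, colorIndicator]
  by_cases h1 : col i (s i) = c <;> by_cases h2 : col j (s j) = c <;> simp [h1, h2]

/-- For any color functions, independence gives a match on one edge probability p(c)², which must be
1 / n²; so uniformity is forced. -/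
theorem color_law_eq (hn : 3 ≤ n) (hS : ∀ a, S.dist a = (colorStrategy hn' W).dist a)
    (c : Fin n) : p c = 1 / (n : ℝ) := by
  let i : Fin n := ⟨0, by omega⟩
  let j : Fin n := ⟨1, by omega⟩
  have hij : i ≠ j := by simp [i, j]
  have h := integral_match hn hS hij c
  rw [integral_congr_ae (ae_response_match hCM hij c), ClassicalStrategy.messageLaw,
    integral_mul_of_dependsOn (A := {i}) (B := {j}) (by simpa using hij)
      (by simpa using dependsOn_colorIndicator i c) (by simpa using dependsOn_colorIndicator j c)
      (measurable_colorIndicator hCM i c) (measurable_colorIndicator hCM j c)] at h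
  have e (v) := integral_colorIndicator hCM v c
  rw [ClassicalStrategy.messageLaw] at e
  rw [e, e, ← sq] at h
  have hp : 0 ≤ p c := by rw [← hCM.color_law i c]; exact measureReal_nonneg
  exact (pow_left_inj₀ hp (by positivity) two_ne_zero).mp h

theorem integral_prod_colorIndicator (T : Finset (Fin n)) (c : Fin n → Fin n) :
    ∫ s, ∏ i ∈ T, colorIndicator col i (c i) s ∂S.messageLaw = ∏ i ∈ T, p (c i) := by
  have h1 (s : ∀ i, S.Msg i) : ∏ i ∈ T, colorIndicator col i (c i) s =
      ∏ i, if i ∈ T then (if col i (s i) = c i then (1 : ℝ) else 0) else 1 := by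
    rw [Finset.prod_ite_mem, Finset.univ_inter]
    rfl
  simp only [h1]
  rw [ClassicalStrategy.messageLaw, integral_fintype_prod_eq_prod
    (f := fun i (x : S.Msg i) => if i ∈ T then (if col i x = c i then (1 : ℝ) else 0) else 1)]
  rw [← Finset.univ_inter T, ← Finset.prod_ite_mem]
  refine Finset.prod_congr rfl fun i _ => ?_
  by_cases hi : i ∈ T
  · simp only [if_pos hi, Finset.mem_inter, Finset.mem_univ, true_and]
    rw [← hCM.color_law i (c i)]
    exact integral_ite_one_zero (hCM.measurable_col i (measurableSet_singleton (c i)))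
  · simp [hi]

theorem dependsOn_response_mul_colorIndicator (e : Edge n) (α : Outcome n e) (a b : Fin n) :
    DependsOn (fun s => S.response s e α *
      (colorIndicator col e.1.1 a s * colorIndicator col e.1.2 b s)) {e.1.1, e.1.2} := by
  intro x y hxy
  have h1 := dependsOn_response S e α hxy
  have h2 : colorIndicator col e.1.1 a x = colorIndicator col e.1.1 a y :=
    dependsOn_colorIndicator _ _ fun i hi => hxy i (Or.inl hi)
  have h3 : colorIndicator col e.1.2 b x = colorIndicator col e.1.2 b y :=
    dependsOn_colorIndicator _ _ fun i hi => hxy i (Or.inr hi)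
  simp only at h1 ⊢
  rw [h1, h2, h3]

theorem measurable_response_mul_colorIndicator (e : Edge n) (α : Outcome n e) (a b : Fin n) :
    Measurable (fun s => S.response s e α *
      (colorIndicator col e.1.1 a s * colorIndicator col e.1.2 b s)) :=
  (measurable_response S e α).mul
    ((measurable_colorIndicator hCM _ _).mul (measurable_colorIndicator hCM _ _))

/-- The law of an output given the colors of the two sources is that of the quantum strategy. -/
theorem integral_response_mul_colorIndicator (hn : 5 ≤ n)
    (hS : ∀ a, S.dist a = (colorStrategy hn' W).dist a) (e : Edge n) (α : Outcome n e)
    (a b : Fin n) :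
    ∫ s, S.response s e α * (colorIndicator col e.1.1 a s * colorIndicator col e.1.2 b s)
      ∂S.messageLaw = ‖W.basisVector e α (a, b)‖ ^ 2 * (1 / (n : ℝ)) ^ 2 := by
  have hn3 : 3 ≤ n := by omega
  -- Two further sources witness the colors of the ends of `e`. Their own color indicators are
  -- independent of the rest, and their factor 1 / n² cancels.
  obtain ⟨k, hik, hjk⟩ := exists_ne_ne (I := Fin n) (by rw [Fintype.card_fin]; omega) e.1.1 e.1.2
  obtain ⟨l, hl⟩ : ∃ l, l ∉ ({e.1.1, e.1.2, k} : Finset (Fin n)) := by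
    by_contra! h
    have h1 := Finset.card_le_card (fun x _ => h x : Finset.univ ⊆ _)
    have h2 := h1.trans Finset.card_le_three
    rw [Finset.card_univ, Fintype.card_fin] at h2
    omega
  simp only [Finset.mem_insert, Finset.mem_singleton, not_or] at hl
  obtain ⟨hil, hjl, hkl⟩ := hl
  have h := integral_response_mul_match_mul_match hn3 hS e α hik hjk (Ne.symm hil) (Ne.symm hjl)
    (Ne.symm hkl) a b
  have hae : (fun s => S.response s e α * (S.response s (.between e.1.1 k hik) (matchOutcome n _ a) *
      S.response s (.between e.1.2 l (Ne.symm hjl)) (matchOutcome n _ b))) =ᵐ[S.messageLaw]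
      fun s => (S.response s e α * (colorIndicator col e.1.1 a s * colorIndicator col e.1.2 b s)) *
        (colorIndicator col k a s * colorIndicator col l b s) := by
    filter_upwards [ae_response_match hCM hik a, ae_response_match hCM (Ne.symm hjl) b]
      with s h1 h2
    rw [h1, h2]; ring
  have e (v c) := integral_colorIndicator hCM v c
  simp only [color_law_eq hCM hn3 hS, ClassicalStrategy.messageLaw] at e
  rw [integral_congr_ae hae, ClassicalStrategy.messageLaw,
    integral_mul_of_dependsOn (A := {_, _}) (B := {k, l}) _
      (by simpa using dependsOn_response_mul_colorIndicator hCM _ α a b)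
      (G := fun s => colorIndicator col k a s * colorIndicator col l b s) _
      (measurable_response_mul_colorIndicator hCM _ α a b)
      ((measurable_colorIndicator hCM _ _).mul (measurable_colorIndicator hCM _ _)),
    integral_mul_of_dependsOn (A := {k}) (B := {l}) (by simpa using Ne.symm hkl)
      (by simpa using dependsOn_colorIndicator k a) (by simpa using dependsOn_colorIndicator l b)
      (measurable_colorIndicator hCM k a) (measurable_colorIndicator hCM l b), e, e] at h
  · have hn0 : (1 / (n : ℝ)) * (1 / (n : ℝ)) ≠ 0 := by positivity
    apply mul_right_cancel₀ hn0
    rw [ClassicalStrategy.messageLaw, h]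
    ring
  · simp only [Finset.disjoint_insert_left, Finset.disjoint_singleton_left, Finset.mem_insert,
      Finset.mem_singleton, not_or]
    exact ⟨⟨hik, Ne.symm hil⟩, hjk, Ne.symm hjl⟩
  · intro x y hxy
    simp only
    rw [dependsOn_colorIndicator (col := col) k a (x := x) (y := y) fun i hi =>
        hxy i (by simp [show i = k from hi]),
      dependsOn_colorIndicator (col := col) l b (x := x) (y := y) fun i hi =>
        hxy i (by simp [show i = l from hi])]

/-- A zero amplitude at (a, b) gives the output zero probability jointly with these colors; there
are finitely many cases, so one null set suffices. -/
theorem ae_basisVector_ne_zero (hn : 5 ≤ n)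
    (hS : ∀ a, S.dist a = (colorStrategy hn' W).dist a) :
    ∀ᵐ s ∂S.messageLaw, ∀ e (α : Outcome n e), 0 < S.response s e α →
      W.basisVector e α (col e.1.1 (s e.1.1), col e.1.2 (s e.1.2)) ≠ 0 := by
  have key (e : Edge n) (α : Outcome n e) (a b : Fin n) (h0 : W.basisVector e α (a, b) = 0) :
      ∀ᵐ s ∂S.messageLaw, S.response s e α *
        (colorIndicator col e.1.1 a s * colorIndicator col e.1.2 b s) = 0 := by
    have h := integral_response_mul_colorIndicator hCM hn hS e α a b
    rw [h0, norm_zero, zero_pow two_ne_zero, zero_mul] at h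
    have h01 (s) : S.response s e α *
        (colorIndicator col e.1.1 a s * colorIndicator col e.1.2 b s) ∈ Set.Icc (0 : ℝ) 1 :=
      mul_mem_Icc_zero_one (response_mem_Icc S s e α)
        (mul_mem_Icc_zero_one (colorIndicator_mem_Icc _ _ s) (colorIndicator_mem_Icc _ _ s))
    exact (integral_eq_zero_iff_of_nonneg (fun s => (h01 s).1)
      (integrable_of_mem_Icc (measurable_response_mul_colorIndicator hCM e α a b) h01)).mp h
  have hall : ∀ᵐ s ∂S.messageLaw, ∀ e (α : Outcome n e) (a b : Fin n),
      W.basisVector e α (a, b) = 0 → S.response s e α *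
        (colorIndicator col e.1.1 a s * colorIndicator col e.1.2 b s) = 0 := by
    refine ae_all_iff.mpr fun e => ae_all_iff.mpr fun α => ae_all_iff.mpr fun a =>
      ae_all_iff.mpr fun b => ?_
    by_cases h0 : W.basisVector e α (a, b) = 0
    · filter_upwards [key e α a b h0] with s hs _
      exact hs
    · exact .of_forall fun s h => absurd h h0
  filter_upwards [hall] with s hs e α hpos h0
  have := hs e α _ _ h0
  simp only [colorIndicator, if_true, mul_one] at this
  exact hpos.ne' this

theorem ae_colors_of_ambiguous (hn : 5 ≤ n)
    (hS : ∀ a, S.dist a = (colorStrategy hn' W).dist a) :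
    ∀ᵐ s ∂S.messageLaw, (∀ e, ∃ r, 0 < S.response s e (ambiguousOutcome n e r)) →
      (∀ i, col i (s i) = i) ∨ (∀ i, col i (s i) = i.rev) := by
  filter_upwards [ae_basisVector_ne_zero hCM hn hS] with s hs hamb
  exact W.eq_id_or_eq_rev hn (fun i => col i (s i)) fun e =>
    (hamb e).imp fun r hr => hs e _ hr

end ColorMatching

/-! ### Measurement angles with a destructive interference -/

/-- Summation by parts: the weight L - k counts the j < L with j ≥ k. -/
theorem sum_range_mul_sub (f : ℕ → ℤ) (L : ℕ) :
    ∑ k ∈ Finset.range L, f k * ((L - k : ℕ) : ℤ) =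
      ∑ j ∈ Finset.range L, ∑ k ∈ Finset.range (j + 1), f k := by
  induction L with
  | zero => simp
  | succ L ih =>
    rw [Finset.sum_range_succ (fun j => ∑ k ∈ Finset.range (j + 1), f k), ← ih,
      Finset.sum_range_succ, Finset.sum_range_succ f, ← add_assoc, ← Finset.sum_add_distrib]
    congr 1
    · refine Finset.sum_congr rfl fun k hk => ?_
      have := Finset.mem_range.mp hk
      rw [Nat.succ_sub this.le]
      push_cast; ring
    · simp

/-- Truncated subtraction discards k > L. Partial alternating sums of a binomial row give the
previous row up to sign; summation by parts uses this twice, descending from m + 2 to m. -/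
theorem sum_alternating_truncated (m L : ℕ) (hL : L < m + 2) :
    ∑ k ∈ Finset.range (m + 3), (-1 : ℤ) ^ k * ((m + 2).choose k : ℤ) * ((L + 1 - k : ℕ) : ℤ) =
      (-1) ^ L * (m.choose L : ℤ) := by
  rw [← Finset.sum_subset (Finset.range_subset_range.mpr (by omega : L + 1 ≤ m + 3)),
    sum_range_mul_sub]
  · simp only [Int.alternating_sum_range_choose_eq_choose]
  · intro k _ hk
    rw [Finset.mem_range, not_lt] at hk
    rw [Nat.sub_eq_zero_of_le hk]
    simp

section Angles

variable {E : Type} [Fintype E] [DecidableEq E]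

/-- Grouping by cardinality, with |E| = m + 2 and threshold L + 1, gives ± the binomial coefficient
of m over L, and L ≤ m. This is the total weight of the interference terms. -/
theorem sum_finset_alternating_ne_zero (hE : 3 ≤ Fintype.card E) :
    ∑ t : Finset E, (((Fintype.card E + 1) / 2 - t.card : ℕ) : ℤ) * (-1) ^ t.card ≠ 0 := by
  obtain ⟨m, hm⟩ : ∃ m, Fintype.card E = m + 2 := ⟨Fintype.card E - 2, by omega⟩
  obtain ⟨L, hL⟩ : ∃ L, (Fintype.card E + 1) / 2 = L + 1 :=
    ⟨(Fintype.card E + 1) / 2 - 1, by omega⟩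
  have hLm : L ≤ m := by omega
  have h := Finset.sum_powerset_apply_card
    (fun k => ((L + 1 - k : ℕ) : ℤ) * (-1) ^ k) (x := (Finset.univ : Finset E))
  rw [Finset.powerset_univ, Finset.card_univ, hm] at h
  rw [hL, h]
  have h2 := sum_alternating_truncated m L (by omega)
  have h3 : ∑ k ∈ Finset.range (m + 2 + 1),
      (m + 2).choose k • (((L + 1 - k : ℕ) : ℤ) * (-1) ^ k) = (-1) ^ L * (m.choose L : ℤ) := by
    rw [← h2]
    refine Finset.sum_congr rfl fun k _ => ?_
    rw [nsmul_eq_mul]; ring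
  rw [h3]
  have := Nat.choose_pos hLm
  exact mul_ne_zero (pow_ne_zero _ (by norm_num)) (by exact_mod_cast this.ne')

theorem sum_prod_ite_mem (y z : E → ℝ) :
    ∑ t : Finset E, ∏ e, (if e ∈ t then y e else z e) = ∏ e, (y e + z e) := by
  rw [Finset.prod_add, Finset.powerset_univ]
  refine Finset.sum_congr rfl fun t _ => ?_
  rw [Finset.prod_ite]
  congr 1
  · congr 1; ext e; simp
  · congr 1; ext e; simp

theorem sum_card_mul_prod_ite_mem (y z : E → ℝ) (h : ∀ e, y e + z e = 1) :
    ∑ t : Finset E, (t.card : ℝ) * ∏ e, (if e ∈ t then y e else z e) = ∑ e, y e := by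
  have h1 (t : Finset E) : (t.card : ℝ) * ∏ e, (if e ∈ t then y e else z e) =
      ∑ e₀, if e₀ ∈ t then ∏ e, (if e ∈ t then y e else z e) else 0 := by
    rw [Finset.sum_ite_mem, Finset.univ_inter, Finset.sum_const, nsmul_eq_mul]
  simp only [h1]
  rw [Finset.sum_comm]
  refine Finset.sum_congr rfl fun e₀ _ => ?_
  -- Setting `z` to 0 at `e₀` removes exactly the sets that miss `e₀`, so the product formula
  -- applies again.
  have h2 (t : Finset E) : (if e₀ ∈ t then ∏ e, (if e ∈ t then y e else z e) else 0) =
      ∏ e, (if e ∈ t then y e else Function.update z e₀ 0 e) := by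
    split_ifs with ht
    · refine Finset.prod_congr rfl fun e _ => ?_
      by_cases he : e ∈ t
      · simp [he]
      · have : e ≠ e₀ := fun hh => he (hh ▸ ht)
        simp [he, this]
    · rw [Finset.prod_eq_zero (Finset.mem_univ e₀)]
      simp [ht]
  simp only [h2]
  rw [sum_prod_ite_mem, Finset.prod_eq_single e₀]
  · simp
  · intro e _ he
    rw [Function.update_of_ne he, h]
  · simp

theorem sum_sub_card_mul_prod_ite_mem (y z : E → ℝ) (h : ∀ e, y e + z e = 1) (L : ℝ) :
    ∑ t : Finset E, (L - t.card) * ∏ e, (if e ∈ t then y e else z e) = L - ∑ e, y e := by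
  simp only [sub_mul, Finset.sum_sub_distrib, ← Finset.mul_sum]
  rw [sum_card_mul_prod_ite_mem y z h, sum_prod_ite_mem]
  simp [h]

theorem prod_ite_mem_const (t : Finset E) (a b : ℝ) :
    ∏ e, (if e ∈ t then a else b) = a ^ t.card * b ^ (Fintype.card E - t.card) := by
  rw [Finset.prod_ite, Finset.prod_const, Finset.prod_const]
  congr 2
  · congr 1; ext e; simp
  · rw [← Finset.card_compl]
    congr 1; ext e; simp

theorem exists_angles (hE : 3 ≤ Fintype.card E) :
    ∃ (c : ℝ) (σ : E → ℝ) (L : ℕ), (∀ e, c ^ 2 + σ e ^ 2 = 1) ∧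
      ∑ t : Finset E, ((L - t.card : ℕ) : ℝ) *
        (∏ e, (if e ∈ t then -σ e else c) + ∏ e, (if e ∈ t then c else σ e)) ^ 2 <
          L - ∑ e, σ e ^ 2 := by
  set m := Fintype.card E with hm
  set L := (m + 1) / 2 with hL
  set T : ℤ := ∑ t : Finset E, ((L - t.card : ℕ) : ℤ) * (-1) ^ t.card with hT
  have hT0 : T ≠ 0 := sum_finset_alternating_ne_zero hE
  -- The sign `τ`, carried by a single angle, makes the interference negative. Integrality of `T`
  -- bounds it away from 0.
  obtain ⟨τ, hτ, hτT⟩ : ∃ τ : ℝ, τ ^ 2 = 1 ∧ τ * T ≤ -1 := by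
    rcases lt_or_gt_of_ne hT0 with h | h
    · exact ⟨1, by norm_num, by rw [one_mul]; exact_mod_cast (by omega : T ≤ -1)⟩
    · exact ⟨-1, by norm_num, by
        have : (1 : ℝ) ≤ T := by exact_mod_cast h
        linarith⟩
  have hm0 : (3 : ℝ) ≤ m := by exact_mod_cast hE
  -- Chosen so that the total error 2^m · m · s^(m+1) is 2^(-m) s^m, below the interference, which
  -- is at least 2 c^m s^m with c ≥ 1/2.
  set s : ℝ := 1 / (4 ^ m * m) with hs
  have hs0 : 0 < s := by positivity
  have hs2 : s ≤ 1 / 2 := by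
    have h4 : (1 : ℝ) ≤ 4 ^ m := one_le_pow₀ (by norm_num)
    rw [hs]
    apply one_div_le_one_div_of_le (by norm_num)
    nlinarith
  have hs1 : s ≤ 1 := by linarith
  set c : ℝ := Real.sqrt (1 - s ^ 2) with hc
  have hcs : c ^ 2 = 1 - s ^ 2 := Real.sq_sqrt (by nlinarith)
  have hc0 : 0 ≤ c := Real.sqrt_nonneg _
  have hc2 : 1 / 2 ≤ c := Real.le_sqrt_of_sq_le (by nlinarith)
  have hc1 : c ^ 2 ≤ 1 := by nlinarith
  obtain ⟨e₀⟩ : Nonempty E := Fintype.card_pos_iff.mp (by omega)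
  set σ : E → ℝ := fun e => if e = e₀ then τ * s else s with hσ
  have hσ2 (e : E) : σ e ^ 2 = s ^ 2 := by
    simp only [hσ]
    split_ifs
    · rw [mul_pow, hτ, one_mul]
    · rfl
  have hσprod : ∏ e, σ e = τ * s ^ m := by
    have : ∀ e, σ e = (if e = e₀ then τ else 1) * s := fun e => by
      simp only [hσ]; split_ifs <;> simp
    simp only [this, Finset.prod_mul_distrib, Finset.prod_const, Finset.card_univ]
    simp [hm]
  refine ⟨c, σ, L, fun e => by rw [hσ2, hcs]; ring, ?_⟩
  set A : Finset E → ℝ := fun t => ∏ e, (if e ∈ t then -σ e else c) with hA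
  set B : Finset E → ℝ := fun t => ∏ e, (if e ∈ t then c else σ e) with hB
  have hA2 (t) : A t ^ 2 = ∏ e, (if e ∈ t then s ^ 2 else c ^ 2) := by
    simp only [hA, ← Finset.prod_pow]
    refine Finset.prod_congr rfl fun e _ => ?_
    split_ifs
    · rw [neg_sq, hσ2]
    · rfl
  have hB2 (t) : B t ^ 2 = ∏ e, (if e ∈ t then c ^ 2 else s ^ 2) := by
    simp only [hB, ← Finset.prod_pow]
    refine Finset.prod_congr rfl fun e _ => ?_
    split_ifs
    · rfl
    · rw [hσ2]
  -- Each edge contributes c σ_e to the cross term, with a minus sign exactly when it lies in `t`.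
  have hAB (t) : A t * B t = c ^ m * (τ * s ^ m) * (-1) ^ t.card := by
    have h1 : A t * B t = (∏ e, (c * σ e)) * ∏ e, (if e ∈ t then (-1 : ℝ) else 1) := by
      simp only [hA, hB, ← Finset.prod_mul_distrib]
      refine Finset.prod_congr rfl fun e _ => ?_
      split_ifs <;> ring
    rw [h1, prod_ite_mem_const, Finset.prod_mul_distrib, hσprod, Finset.prod_const,
      Finset.card_univ, one_pow, mul_one]
  have hcard (t : Finset E) : t.card ≤ m := Finset.card_le_univ t
  -- The threshold L = ⌊(m + 1) / 2⌋ sits in the middle: |t| > L here, and |t| < L for `B`, both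
  -- give an exponent at least m + 1, one order beyond the interference. At |t| = L the weight is
  -- zero.
  have hAle (t : Finset E) (ht : L < t.card) : A t ^ 2 ≤ s ^ (m + 1) := by
    rw [hA2, prod_ite_mem_const, ← pow_mul]
    calc s ^ (2 * t.card) * (c ^ 2) ^ (Fintype.card E - t.card)
        ≤ s ^ (2 * t.card) * 1 := by
          gcongr
          exact pow_le_one₀ (sq_nonneg c) hc1
      _ ≤ s ^ (m + 1) := by
          rw [mul_one]
          exact pow_le_pow_of_le_one hs0.le hs1 (by omega)
  have hBle (t : Finset E) (ht : t.card < L) : B t ^ 2 ≤ s ^ (m + 1) := by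
    rw [hB2, prod_ite_mem_const, ← pow_mul s]
    calc (c ^ 2) ^ t.card * s ^ (2 * (Fintype.card E - t.card))
        ≤ 1 * s ^ (2 * (Fintype.card E - t.card)) := by
          gcongr
          exact pow_le_one₀ (sq_nonneg c) hc1
      _ ≤ s ^ (m + 1) := by
          rw [one_mul]
          exact pow_le_pow_of_le_one hs0.le hs1 (by omega)
  have hsumA : ∑ t : Finset E, ((L : ℝ) - t.card) * A t ^ 2 = L - ∑ e, σ e ^ 2 := by
    simp only [hA2, hσ2]
    exact sum_sub_card_mul_prod_ite_mem (fun _ => s ^ 2) (fun _ => c ^ 2)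
      (fun _ => by rw [hcs]; ring) L
  -- Beyond `L`, the error term pays for replacing the truncated weight by L - |t| in front of A²;
  -- below `L`, it pays for B².
  have hterm (t : Finset E) : ((L - t.card : ℕ) : ℝ) * (A t + B t) ^ 2 ≤
      ((L : ℝ) - t.card) * A t ^ 2 + m * s ^ (m + 1) +
        2 * c ^ m * (τ * s ^ m) * (((L - t.card : ℕ) : ℝ) * (-1) ^ t.card) := by
    have hpow : 0 ≤ s ^ (m + 1) := by positivity
    have h1 := hAB t
    have hexp : (A t + B t) ^ 2 = A t ^ 2 + B t ^ 2 + 2 * (A t * B t) := by ring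
    rw [hexp, h1]
    rcases lt_trichotomy t.card L with h | h | h
    · rw [Nat.cast_sub h.le]
      have h2 : ((L : ℝ) - t.card) * B t ^ 2 ≤ m * s ^ (m + 1) := by
        have h3 : (0 : ℝ) ≤ (L : ℝ) - t.card := by
          rw [sub_nonneg]; exact_mod_cast h.le
        have h4 : (L : ℝ) - t.card ≤ m := by
          have : (L : ℝ) ≤ m := by exact_mod_cast (by omega : L ≤ m)
          have : (0 : ℝ) ≤ t.card := by positivity
          linarith
        calc _ ≤ ((L : ℝ) - t.card) * s ^ (m + 1) := mul_le_mul_of_nonneg_left (hBle t h) h3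
          _ ≤ _ := mul_le_mul_of_nonneg_right h4 hpow
      nlinarith
    · rw [h, Nat.sub_self, Nat.cast_zero]
      have : 0 ≤ (m : ℝ) * s ^ (m + 1) := by positivity
      simpa using this
    · rw [Nat.sub_eq_zero_of_le h.le, Nat.cast_zero]
      have h2 : ((t.card : ℝ) - L) * A t ^ 2 ≤ m * s ^ (m + 1) := by
        have h3 : (0 : ℝ) ≤ (t.card : ℝ) - L := by
          rw [sub_nonneg]; exact_mod_cast h.le
        have h4 : (t.card : ℝ) - L ≤ m := by
          have : (t.card : ℝ) ≤ m := by exact_mod_cast hcard t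
          have : (0 : ℝ) ≤ L := by positivity
          linarith
        calc _ ≤ ((t.card : ℝ) - L) * s ^ (m + 1) := mul_le_mul_of_nonneg_left (hAle t h) h3
          _ ≤ _ := mul_le_mul_of_nonneg_right h4 hpow
      linarith
  have hsum := Finset.sum_le_sum fun t (_ : t ∈ (Finset.univ : Finset (Finset E))) => hterm t
  rw [Finset.sum_add_distrib, Finset.sum_add_distrib, hsumA, Finset.sum_const,
    Finset.card_univ, Fintype.card_finset, nsmul_eq_mul, ← Finset.mul_sum] at hsum
  have hTreal : ∑ t : Finset E, ((L - t.card : ℕ) : ℝ) * (-1) ^ t.card = T := by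
    rw [hT]; push_cast; rfl
  rw [hTreal] at hsum
  refine lt_of_le_of_lt hsum ?_
  have hsm : 0 < s ^ m := by positivity
  have hcm : (1 / 2) ^ m ≤ c ^ m := pow_le_pow_left₀ (by norm_num) hc2 m
  have hcm0 : 0 < c ^ m := lt_of_lt_of_le (by positivity) hcm
  have h5 : (2 : ℝ) ^ m * (m * s) = (1 / 2) ^ m := by
    rw [hs, show (4 : ℝ) = 2 * 2 by norm_num, mul_pow, one_div_pow]
    field_simp
  have h6 : ((2 ^ Fintype.card E : ℕ) : ℝ) * (m * s ^ (m + 1)) = (1 / 2) ^ m * s ^ m := by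
    rw [← h5, pow_succ]; push_cast; ring
  have h7 : 2 * c ^ m * (τ * s ^ m) * T = 2 * (c ^ m * s ^ m) * (τ * T) := by ring
  rw [h6, h7]
  have h8 : (1 / 2) ^ m * s ^ m ≤ c ^ m * s ^ m := mul_le_mul_of_nonneg_right hcm hsm.le
  have h9 : 0 < c ^ m * s ^ m := by positivity
  nlinarith

end Angles

/-! ### A nonlocal choice of the parameters -/

section Rotation

variable {P : Type} [Fintype P] [DecidableEq P]

/-- The matrix that acts on the coordinates `a` and `b` as a rotation with cosine `c` and sine `σ`,
and fixes the other coordinates. -/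
def planeRotation (a b : P) (c σ : ℝ) : Matrix P P ℂ := Matrix.of fun ρ =>
  if ρ = a then Pi.single a (c : ℂ) + Pi.single b (σ : ℂ)
  else if ρ = b then Pi.single a (-σ : ℂ) + Pi.single b (c : ℂ)
  else Pi.single ρ 1

theorem planeRotation_left (a b : P) (c σ : ℝ) :
    planeRotation a b c σ a = Pi.single a (c : ℂ) + Pi.single b (σ : ℂ) := if_pos rfl

theorem planeRotation_right {a b : P} (hab : a ≠ b) (c σ : ℝ) :
    planeRotation a b c σ b = Pi.single a (-σ : ℂ) + Pi.single b (c : ℂ) :=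
  (if_neg hab.symm).trans (if_pos rfl)

theorem planeRotation_of_ne {a b ρ : P} (ha : ρ ≠ a) (hb : ρ ≠ b) (c σ : ℝ) :
    planeRotation a b c σ ρ = Pi.single ρ 1 :=
  (if_neg ha).trans (if_neg hb)

theorem planeRotation_mul_conjTranspose {a b : P} (hab : a ≠ b) {c σ : ℝ}
    (h : c ^ 2 + σ ^ 2 = 1) :
    planeRotation a b c σ * (planeRotation a b c σ).conjTranspose = 1 := by
  have h' : (c : ℂ) ^ 2 + (σ : ℂ) ^ 2 = 1 := by exact_mod_cast h
  have hsingle (x : P) (r : ℂ) (hr : star r = r) :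
      star (Pi.single x r : P → ℂ) = Pi.single x r := by
    rw [← Pi.single_star, hr]
  have hstar (ρ) : star (planeRotation a b c σ ρ) = planeRotation a b c σ ρ := by
    by_cases h1 : ρ = a
    · rw [h1, planeRotation_left, star_add, hsingle _ _ (by simp), hsingle _ _ (by simp)]
    · by_cases h2 : ρ = b
      · rw [h2, planeRotation_right hab, star_add, hsingle _ _ (by simp), hsingle _ _ (by simp)]
      · rw [planeRotation_of_ne h1 h2, hsingle _ _ (by simp)]
  have hdot (ρ ρ') : (planeRotation a b c σ * (planeRotation a b c σ).conjTranspose) ρ ρ' =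
      (planeRotation a b c σ ρ) ⬝ᵥ (planeRotation a b c σ ρ') := by
    rw [← hstar ρ']
    rfl
  ext ρ ρ'
  rw [hdot, Matrix.one_apply]
  have hba := hab.symm
  by_cases h1 : ρ = a
  · rw [h1, planeRotation_left]
    by_cases h2 : ρ' = a
    · rw [h2, planeRotation_left]
      simp [hab, hba]
      linear_combination h'
    · by_cases h3 : ρ' = b
      · rw [h3, planeRotation_right hab]
        simp [hab, hba]
        ring
      · rw [planeRotation_of_ne h2 h3]
        simp [h2, h3, Ne.symm h2]
  · by_cases h1' : ρ = b
    · rw [h1', planeRotation_right hab]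
      by_cases h2 : ρ' = a
      · rw [h2, planeRotation_left]
        simp [hab, hba]
        ring
      · by_cases h3 : ρ' = b
        · rw [h3, planeRotation_right hab]
          simp [hab, hba]
          linear_combination h'
        · rw [planeRotation_of_ne h2 h3]
          simp [h2, h3, Ne.symm h3]
    · rw [planeRotation_of_ne h1 h1']
      by_cases h2 : ρ' = a
      · rw [h2, planeRotation_left]
        simp [h1, h1']
      · by_cases h3 : ρ' = b
        · rw [h3, planeRotation_right hab]
          simp [h1, h1']
        · rw [planeRotation_of_ne h2 h3]
          simp [Pi.single_apply, eq_comm]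

end Rotation

variable {n : ℕ}

/-- The pair of colors `(i, j)` at the edge `(i, j)`. -/
def Edge.idPair (e : Edge n) : AmbiguousPair n e :=
  ⟨(e.1.1, e.1.2), ne_of_lt e.2, Or.inl rfl⟩

/-- The pair of colors `(n + 1 - i, n + 1 - j)` at the edge `(i, j)`. -/
def Edge.revPair (e : Edge n) : AmbiguousPair n e :=
  ⟨(e.1.1.rev, e.1.2.rev), fun h => ne_of_lt e.2 (Fin.rev_injective h), Or.inr (by
    have h1 := e.1.1.2
    have h2 := e.1.2.2
    simp only [Fin.val_rev]
    omega)⟩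

/-- Equality would put both ends of the edge at the middle vertex. -/
theorem Edge.idPair_ne_revPair (e : Edge n) : e.idPair ≠ e.revPair := by
  intro h
  have h1 := congrArg (fun q => (q.1.1 : ℕ)) h
  have h2 := congrArg (fun q => (q.1.2 : ℕ)) h
  have h3 := e.1.1.2
  have h4 := e.1.2.2
  have h5 : (e.1.1 : ℕ) < e.1.2 := e.2
  simp only [Edge.idPair, Edge.revPair, Fin.val_rev] at h1 h2
  omega

/-- The measurement bases that superpose the pairs of colors `(i, j)` and `(n + 1 - i, n + 1 - j)`
by a rotation with cosine `c` and sine `σ e`. -/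
noncomputable def rotationParams (c : ℝ) (σ : Edge n → ℝ) (h : ∀ e, c ^ 2 + σ e ^ 2 = 1) :
    MeasurementParams n where
  ω e := (planeRotation e.idPair e.revPair c (σ e)).submatrix
    (Fintype.equivFin (AmbiguousPair n e)).symm id
  orthonormal e := by
    rw [Matrix.conjTranspose_submatrix, ← Matrix.submatrix_mul _ _ _ _ _ Function.bijective_id,
      planeRotation_mul_conjTranspose e.idPair_ne_revPair (h e)]
    exact Matrix.submatrix_one_equiv _

/-- The ambiguous output for which the amplitude of the colors `(i, j)` is `c` (if `b` is false), or
for which that of `(n + 1 - i, n + 1 - j)` is `c` (if `b` is true). -/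
noncomputable def rotatedOutcome (e : Edge n) (b : Prop) [Decidable b] : Outcome n e :=
  ambiguousOutcome n e (Fintype.equivFin (AmbiguousPair n e) (if b then e.revPair else e.idPair))

section

variable {c : ℝ} {σ : Edge n → ℝ} (h : ∀ e, c ^ 2 + σ e ^ 2 = 1)

theorem basisVector_rotatedOutcome (e : Edge n) (b : Prop) [Decidable b] (q : AmbiguousPair n e) :
    (rotationParams c σ h).basisVector e (rotatedOutcome e b) q.1 =
      planeRotation e.idPair e.revPair c (σ e) (if b then e.revPair else e.idPair) q := by
  simp only [rotatedOutcome, MeasurementParams.basisVector]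
  rw [dif_pos q.2]
  simp [rotationParams]

theorem basisVector_rotatedOutcome_id (e : Edge n) (b : Prop) [Decidable b] :
    (rotationParams c σ h).basisVector e (rotatedOutcome e b) (e.1.1, e.1.2) =
      ((if b then -σ e else c : ℝ) : ℂ) := by
  have h1 := basisVector_rotatedOutcome h e b e.idPair
  have h2 := e.idPair_ne_revPair
  refine h1.trans ?_
  by_cases hb : b <;> simp [planeRotation, hb, h2, h2.symm]

theorem basisVector_rotatedOutcome_rev (e : Edge n) (b : Prop) [Decidable b] :
    (rotationParams c σ h).basisVector e (rotatedOutcome e b) (e.1.1.rev, e.1.2.rev) =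
      ((if b then c else σ e : ℝ) : ℂ) := by
  have h1 := basisVector_rotatedOutcome h e b e.revPair
  have h2 := e.idPair_ne_revPair
  refine h1.trans ?_
  by_cases hb : b <;> simp [planeRotation, hb, h2.symm]

/-- These outputs are all ambiguous, so part 1 leaves only the amplitudes of the identity and
reversed colorings. -/
theorem dist_rotatedOutcome (hn' : 2 ≤ n) (hn : 5 ≤ n) (t : Finset (Edge n)) :
    (colorStrategy hn' (rotationParams c σ h)).dist (fun e => rotatedOutcome e (e ∈ t)) =
      (1 / (n : ℝ)) ^ n *
        (∏ e, (if e ∈ t then -σ e else c) + ∏ e, (if e ∈ t then c else σ e)) ^ 2 := by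
  rw [colorStrategy_dist]
  congr 1
  have hne : (fun i : Fin n => i) ≠ fun i => i.rev := by
    intro hh
    have := congrArg Fin.val (congrFun hh ⟨0, by omega⟩)
    simp only [Fin.val_rev] at this
    omega
  rw [← Finset.sum_subset (Finset.subset_univ {fun i => i, fun i => i.rev}),
    Finset.sum_pair hne]
  · have h1 := fun e => basisVector_rotatedOutcome_id h e (e ∈ t)
    have h2 := fun e => basisVector_rotatedOutcome_rev h e (e ∈ t)
    simp only [Edge.colors, h1, h2]
    rw [← Complex.ofReal_prod, ← Complex.ofReal_prod, ← Complex.ofReal_add, Complex.norm_real,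
      Real.norm_eq_abs, sq_abs]
  · intro c' _ hc'
    by_contra hprod
    rw [← ne_eq, Finset.prod_ne_zero_iff] at hprod
    apply hc'
    rw [Finset.mem_insert, Finset.mem_singleton]
    exact ((rotationParams c σ h).eq_id_or_eq_rev hn c' fun e =>
      ⟨_, hprod e (Finset.mem_univ e)⟩).imp funext funext

end

theorem three_le_card_edge (hn : 5 ≤ n) : 3 ≤ Fintype.card (Edge n) := by
  let v (k : Fin 3) : Edge n := ⟨(⟨0, by omega⟩, ⟨k + 1, by omega⟩), by simp [Fin.lt_def]⟩
  have hv : Function.Injective v := by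
    intro a b hab
    have := congrArg (fun e : Edge n => (e.1.2 : ℕ)) hab
    simp only [v] at this
    exact Fin.ext (by omega)
  simpa using Fintype.card_le_of_injective v hv

/-! ### The classical bound violated by the rotated measurements. -/

section Nonlocality

variable {S : ClassicalStrategy.{u} (completeNetwork n) (Outcome n)} {hn' : 2 ≤ n}
  {W : MeasurementParams n} {col : ∀ i, S.Msg i → Fin n} {p : Fin n → ℝ}
  (hCM : S.IsColorMatching (matchOutcome n) p col)
include hCM

/-- The joint probability of an output of `e` and of colors of all the sources. -/
theorem integral_response_mul_prod_colorIndicator (hn : 5 ≤ n)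
    (hS : ∀ a, S.dist a = (colorStrategy hn' W).dist a) (e : Edge n) (α : Outcome n e)
    (c : Fin n → Fin n) :
    ∫ s, (∏ i, colorIndicator col i (c i) s) * S.response s e α ∂S.messageLaw =
      (1 / (n : ℝ)) ^ n * ‖W.basisVector e α (e.colors c)‖ ^ 2 := by
  have hij : e.1.1 ≠ e.1.2 := ne_of_lt e.2
  set T : Finset (Fin n) := {e.1.1, e.1.2} with hT
  have hTc : T.card = 2 := Finset.card_pair hij
  have h1 (s) : (∏ i, colorIndicator col i (c i) s) * S.response s e α =
      (S.response s e α * (colorIndicator col e.1.1 (c e.1.1) s *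
        colorIndicator col e.1.2 (c e.1.2) s)) * ∏ i ∈ Tᶜ, colorIndicator col i (c i) s := by
    rw [← Finset.prod_mul_prod_compl T, hT, Finset.prod_pair hij]
    ring
  have h2 : Tᶜ.card = n - 2 := by rw [Finset.card_compl, hTc, Fintype.card_fin]
  have h3 := integral_prod_colorIndicator hCM Tᶜ c
  have h4 := integral_response_mul_colorIndicator hCM hn hS e α (c e.1.1) (c e.1.2)
  simp only [color_law_eq hCM (by omega : 3 ≤ n) hS, Finset.prod_const, h2] at h3
  simp only [ClassicalStrategy.messageLaw] at h3 h4 ⊢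
  simp only [h1]
  rw [integral_mul_of_dependsOn (A := T) (B := Tᶜ) disjoint_compl_right
    (by simpa [hT] using dependsOn_response_mul_colorIndicator hCM e α (c e.1.1) (c e.1.2))
    (G := fun s => ∏ i ∈ Tᶜ, colorIndicator col i (c i) s) _
    (measurable_response_mul_colorIndicator hCM _ _ _ _)
    (Finset.measurable_prod _ fun i _ => measurable_colorIndicator hCM i _), h3, h4]
  · have : (1 / (n : ℝ)) ^ n = (1 / (n : ℝ)) ^ 2 * (1 / (n : ℝ)) ^ (n - 2) := by
      rw [← pow_add]; congr 1; omega
    rw [this, Edge.colors]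
    ring
  · intro x y hxy
    exact Finset.prod_congr rfl fun i hi => dependsOn_colorIndicator i (c i) fun k hk =>
      hxy k (by rw [show k = i from hk]; exact hi)

end Nonlocality

/-- No classical strategy simulates rotations whose interference is destructive where the
outputs resemble those for the colors `c i = i`. -/
theorem not_simulates_of_angles
    {S : ClassicalStrategy.{u} (completeNetwork n) (Outcome n)} {hn' : 2 ≤ n} (hn : 5 ≤ n) {c : ℝ} {σ : Edge n → ℝ} {L : ℕ}
    (h : ∀ e, c ^ 2 + σ e ^ 2 = 1)
    (hlt : ∑ t : Finset (Edge n), ((L - t.card : ℕ) : ℝ) *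
        (∏ e, (if e ∈ t then -σ e else c) + ∏ e, (if e ∈ t then c else σ e)) ^ 2 <
          L - ∑ e, σ e ^ 2)
    (hS : ∀ a, S.dist a = (colorStrategy hn' (rotationParams c σ h)).dist a) : False := by
  obtain ⟨col, hCM⟩ := exists_isColorMatching (by omega : 3 ≤ n) hS
  let χ (s : ∀ i, S.Msg i) : ℝ := ∏ i, colorIndicator col i i s
  let y (e : Edge n) (s : ∀ i, S.Msg i) : ℝ := S.response s e (rotatedOutcome e True)
  let z (e : Edge n) (s : ∀ i, S.Msg i) : ℝ := S.response s e (rotatedOutcome e False)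
  have hχm : Measurable χ := Finset.measurable_prod _ fun i _ => measurable_colorIndicator hCM i i
  have hχ01 (s) : χ s ∈ Set.Icc (0 : ℝ) 1 :=
    ⟨Finset.prod_nonneg fun i _ => (colorIndicator_mem_Icc i i s).1,
      Finset.prod_le_one (fun i _ => (colorIndicator_mem_Icc i i s).1)
        fun i _ => (colorIndicator_mem_Icc i i s).2⟩
  have hχi : Integrable χ S.messageLaw := integrable_of_mem_Icc hχm hχ01
  have hym (e) : Measurable (y e) := measurable_response S _ _
  have hzm (e) : Measurable (z e) := measurable_response S _ _
  have hχy (e) : Integrable (fun s => χ s * y e s) S.messageLaw :=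
    integrable_of_mem_Icc (hχm.mul (hym e)) fun s =>
      mul_mem_Icc_zero_one (hχ01 s) (response_mem_Icc S s _ _)
  have hχz (e) : Integrable (fun s => χ s * z e s) S.messageLaw :=
    integrable_of_mem_Icc (hχm.mul (hzm e)) fun s =>
      mul_mem_Icc_zero_one (hχ01 s) (response_mem_Icc S s _ _)
  have eχ : ∫ s, χ s ∂S.messageLaw = (1 / (n : ℝ)) ^ n := by
    have := integral_prod_colorIndicator hCM Finset.univ fun i => i
    simpa using this
  have ey (e) : ∫ s, χ s * y e s ∂S.messageLaw = (1 / (n : ℝ)) ^ n * σ e ^ 2 := by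
    have h1 := integral_response_mul_prod_colorIndicator hCM hn hS e (rotatedOutcome e True)
      fun i => i
    have h2 := basisVector_rotatedOutcome_id h e True
    rw [Edge.colors, h2, if_pos trivial, Complex.norm_real, Real.norm_eq_abs, sq_abs, neg_sq] at h1
    exact h1
  have ez (e) : ∫ s, χ s * z e s ∂S.messageLaw = (1 / (n : ℝ)) ^ n * c ^ 2 := by
    have h1 := integral_response_mul_prod_colorIndicator hCM hn hS e (rotatedOutcome e False)
      fun i => i
    have h2 := basisVector_rotatedOutcome_id h e False
    rw [Edge.colors, h2, if_neg not_false, Complex.norm_real, Real.norm_eq_abs, sq_abs] at h1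
    exact h1
  have hyz (e s) : y e s + z e s ≤ 1 := by
    have hne : rotatedOutcome e True ≠ rotatedOutcome e False := by
      simp [rotatedOutcome, e.idPair_ne_revPair.symm]
    rw [← sum_response S s e]
    change S.response s e _ + S.response s e _ ≤ _
    rw [← Finset.sum_pair hne]
    exact Finset.sum_le_sum_of_subset_of_nonneg (Finset.subset_univ _)
      fun a _ _ => (response_mem_Icc S s e a).1
  -- On the identity coloring the two rotated outputs have probabilities σ² and c², which sum to 1,
  -- so no other output occurs there.
  have hone : ∀ᵐ s ∂S.messageLaw, ∀ e, χ s * (y e s + z e s) = χ s := by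
    refine ae_all_iff.mpr fun e => ?_
    refine ae_eq_of_le_of_integral_eq (f := fun s => χ s * (y e s + z e s)) ?_ hχi
      (fun s => mul_le_of_le_one_right (hχ01 s).1 (hyz e s)) ?_
    · simp only [mul_add]
      exact (hχy e).add (hχz e)
    · simp only [mul_add]
      rw [integral_add (hχy e) (hχz e), ey, ez, eχ]
      have := h e
      linear_combination (1 / (n : ℝ)) ^ n * this
  let R (t : Finset (Edge n)) (s : ∀ i, S.Msg i) : ℝ := ∏ e, (if e ∈ t then y e s else z e s)
  have hR (t s) : R t s = ∏ e, S.response s e (rotatedOutcome e (e ∈ t)) := by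
    refine Finset.prod_congr rfl fun e _ => ?_
    by_cases he : e ∈ t <;> simp [he, y, z, rotatedOutcome]
  have hR01 (t s) : R t s ∈ Set.Icc (0 : ℝ) 1 := by
    rw [hR]
    exact ⟨Finset.prod_nonneg fun e _ => (response_mem_Icc S s e _).1,
      Finset.prod_le_one (fun e _ => (response_mem_Icc S s e _).1)
        fun e _ => (response_mem_Icc S s e _).2⟩
  have hRm (t) : Measurable (R t) := by
    have : R t = fun s => ∏ e, S.response s e (rotatedOutcome e (e ∈ t)) := funext (hR t)
    rw [this]
    exact Finset.measurable_prod _ fun e _ => measurable_response S e _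
  have hRi (t) : Integrable (R t) S.messageLaw := integrable_of_mem_Icc (hRm t) (hR01 t)
  have eR (t) : ∫ s, R t s ∂S.messageLaw = (1 / (n : ℝ)) ^ n *
      (∏ e, (if e ∈ t then -σ e else c) + ∏ e, (if e ∈ t then c else σ e)) ^ 2 := by
    rw [← dist_rotatedOutcome h hn' hn t, ← hS]
    exact integral_congr_ae (.of_forall (hR t))
  -- Given the messages the outputs are independent, so the mean of L - |t| is L - ∑ y_e. Passing to
  -- (L - |t|)₊ and dropping the indicator `χ` on the right only increases that side, and yields
  -- observable probabilities.
  have hpt : ∀ᵐ s ∂S.messageLaw, (L : ℝ) * χ s - ∑ e, χ s * y e s ≤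
      ∑ t : Finset (Edge n), ((L - t.card : ℕ) : ℝ) * R t s := by
    filter_upwards [hone] with s hs
    have hrhs : 0 ≤ ∑ t : Finset (Edge n), ((L - t.card : ℕ) : ℝ) * R t s :=
      Finset.sum_nonneg fun t _ => mul_nonneg (Nat.cast_nonneg _) (hR01 t s).1
    by_cases h0 : χ s = 0
    · simpa [h0] using hrhs
    have hsum : ∀ e, y e s + z e s = 1 := fun e => by
      have := hs e
      exact mul_left_cancel₀ h0 (this.trans (mul_one _).symm)
    have hw := sum_sub_card_mul_prod_ite_mem (fun e => y e s) (fun e => z e s) hsum L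
    have hle : (L : ℝ) - ∑ e, y e s ≤ ∑ t : Finset (Edge n), ((L - t.card : ℕ) : ℝ) * R t s := by
      rw [← hw]
      refine Finset.sum_le_sum fun t _ => mul_le_mul_of_nonneg_right ?_ (hR01 t s).1
      rw [sub_le_iff_le_add]
      exact_mod_cast (by omega : L ≤ L - t.card + t.card)
    have hfac : (L : ℝ) * χ s - ∑ e, χ s * y e s = χ s * (L - ∑ e, y e s) := by
      rw [← Finset.mul_sum]; ring
    rw [hfac]
    calc χ s * (L - ∑ e, y e s) ≤ χ s * ∑ t : Finset (Edge n), ((L - t.card : ℕ) : ℝ) * R t s :=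
          mul_le_mul_of_nonneg_left hle (hχ01 s).1
      _ ≤ _ := mul_le_of_le_one_left hrhs (hχ01 s).2
  have hint := integral_mono_ae
    ((hχi.const_mul (L : ℝ)).sub (integrable_finsetSum _ fun e _ => hχy e))
    (integrable_finsetSum _ fun t _ => (hRi t).const_mul ((L - t.card : ℕ) : ℝ)) hpt
  have hl : ∫ s, ((L : ℝ) * χ s - ∑ e, χ s * y e s) ∂S.messageLaw =
      (1 / (n : ℝ)) ^ n * (L - ∑ e, σ e ^ 2) := by
    rw [integral_sub (hχi.const_mul (L : ℝ)) (integrable_finsetSum _ fun e _ => hχy e),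
      integral_const_mul, integral_finsetSum _ fun e _ => hχy e, eχ]
    simp only [ey]
    rw [← Finset.mul_sum]
    ring
  have hr : ∫ s, ∑ t : Finset (Edge n), ((L - t.card : ℕ) : ℝ) * R t s ∂S.messageLaw =
      (1 / (n : ℝ)) ^ n * ∑ t : Finset (Edge n), ((L - t.card : ℕ) : ℝ) *
        (∏ e, (if e ∈ t then -σ e else c) + ∏ e, (if e ∈ t then c else σ e)) ^ 2 := by
    rw [integral_finsetSum _ fun t _ => (hRi t).const_mul ((L - t.card : ℕ) : ℝ), Finset.mul_sum]
    refine Finset.sum_congr rfl fun t _ => ?_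
    rw [integral_const_mul, eR]
    ring
  have hint' := (hl.symm.le.trans hint).trans hr.le
  have hpos : 0 < (1 / (n : ℝ)) ^ n := by
    have : (0 : ℝ) < n := by exact_mod_cast (by omega : 0 < n)
    positivity
  exact absurd (le_of_mul_le_mul_left hint' hpos) (not_le.mpr hlt)

end NetworkNonlocality

open NetworkNonlocality
theorem claim3 (n : ℕ) (hn : 5 ≤ n) :
    -- the colors of the (decohered) sources, when all outputs are ambiguous
    (∀ (W : MeasurementParams n) (c : Fin n → Fin n),
      (∀ e : Edge n, ∃ r, W.basisVector e (ambiguousOutcome n e r) (c e.1.1, c e.1.2) ≠ 0) →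
        (∀ i, c i = i) ∨ (∀ i, c i = i.rev)) ∧
    -- the same in every classical strategy that simulates the quantum distribution
    (∀ (W : MeasurementParams n)
      (S : ClassicalStrategy.{u} (completeNetwork n) (Outcome n)),
      (∀ a, S.dist a = (colorStrategy (by omega : 2 ≤ n) W).dist a) →
        (∃ col, S.IsColorMatching (matchOutcome n) (fun _ => 1 / (n : ℝ)) col) ∧
        ∀ p col, S.IsColorMatching (matchOutcome n) p col →
          ∀ᵐ s ∂S.messageLaw,
            (∀ e, ∃ r, 0 < S.response s e (ambiguousOutcome n e r)) →
              (∀ i, col i (s i) = i) ∨ (∀ i, col i (s i) = i.rev)) ∧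
    -- nonlocality
    (∃ W : MeasurementParams n,
      ¬ IsLocal.{u} (completeNetwork n) (colorStrategy (by omega : 2 ≤ n) W).dist) := by
  refine ⟨fun W c => W.eq_id_or_eq_rev hn c, fun W S hS =>
    ⟨exists_isColorMatching (by omega) hS, fun p col hCM => ae_colors_of_ambiguous hCM hn hS⟩, ?_⟩
  obtain ⟨c, σ, L, h, hlt⟩ := exists_angles (three_le_card_edge hn)
  exact ⟨rotationParams c σ h, fun ⟨_, hS⟩ => not_simulates_of_angles hn h hlt hS⟩
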